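/- Let $k$ be a perfect field of characteristic different from $3$, let $K$ be an algebraic function field of one variable over $k$ (a finite extension of $k(x)$ with $x$ transcendental over $k$), and let $K'/K$ be an extension of degree two such that $K'$ has genus zero over its field of constants. Let $T$ be a nonempty finite set of places of $K/k$. Then the following are equivalent: 1. there is a cubic extension $L/K$ such that $K'$ is the purely cubic closure of $L/K$ and such that the places of $K$ that are totally ramified in $L$ are exactly those in $T$; 2. every place in $T$ splits in $K'/K$, i.e. there are exactly two places of $K'$ above it. Here a cubic extension $L/K$ is a separable extension of degree three that is geometric, i.e. not of the form $K\ell$ with $\ell/k$ an extension of degree three; an extension is purely cubic if it is generated by an element with minimal polynomial $X^3-\beta$ with $\beta$ in the base field; and the purely cubic closure of $L/K$ is the smallest extension $M$ of $K$ such that $LM/M$ is purely cubic. All extensions of $K$ are taken inside a fixed algebraic closure of $K$. A place is totally ramified in $L/K$ if some place of $L$ above it has ramification index $3$. -/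

import Mathlib

open IsLocalRing

namespace FunctionFieldPlaces

/-- `K` is an algebraic function field (of one variable) over `k`: it is a finite extension of
`k(x)` for some `x` transcendental over `k`. -/
def IsFunctionField (k K : Type*) [Field k] [Field K] [Algebra k K] : Prop :=
  ∃ x : K, Transcendental k x ∧ FiniteDimensional (IntermediateField.adjoin k {x}) K

/-- A place of `F / k`, given by its valuation ring: a valuation ring `𝒪` of `F` with
`k ⊆ 𝒪 ⊊ F`. -/
@[ext]
structure Place (k F : Type*) [Field k] [Field F] [Algebra k F] where
  ring : ValuationSubring F
  algebraMap_mem : ∀ c : k, algebraMap k F c ∈ ring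
  ne_top : ring ≠ ⊤

section Genus

variable {k F : Type*} [Field k] [Field F] [Algebra k F]

/-- The valuation ring of a place is a `k`-algebra. -/
instance Place.instAlgebraRing (P : Place k F) : Algebra k P.ring :=
  ((algebraMap k F).codRestrict P.ring.toSubring P.algebraMap_mem).toAlgebra

/-- The degree of a place: the degree over `k` of its residue field. -/
noncomputable def Place.degree (P : Place k F) : ℕ :=
  Module.finrank k (ResidueField P.ring)

variable (k F) in
/-- Divisors: formal finite `ℤ`-linear combinations of places. -/
abbrev Divisor : Type _ := Place k F →₀ ℤ

/-- The degree of a divisor. -/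
noncomputable def Divisor.degree (D : Divisor k F) : ℤ :=
  D.sum fun P n => n * (P.degree : ℤ)

/-- The Riemann–Roch space `ℒ(D)`: all `f` with `v_P(f) ≥ -D(P)` at every place `P`. The condition
at `P` is written as `f * π ^ D(P) ∈ 𝒪_P` for a uniformizer `π` at `P` (places of function fields
are discrete, and the choice of the uniformizer does not matter). -/
def riemannRochSpace (D : Divisor k F) : Submodule k F where
  carrier := {f | ∀ (P : Place k F) (π : P.ring), maximalIdeal P.ring = Ideal.span {π} →
    f * (π : F) ^ D P ∈ P.ring}
  zero_mem' := fun P π _ => by simp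
  add_mem' := fun {f g} hf hg P π hπ => by
    rw [add_mul]
    exact P.ring.add_mem _ _ (hf P π hπ) (hg P π hπ)
  smul_mem' := fun c f hf P π hπ => by
    rw [Algebra.smul_def, mul_assoc]
    exact P.ring.mul_mem _ _ (P.algebraMap_mem c) (hf P π hπ)

variable (k F) in
/-- `F`, with field of constants `k`, has genus `g`: `g` is the maximum over all divisors `D` of
`deg D - dim ℒ(D) + 1`. -/
def HasGenus (g : ℤ) : Prop :=
  IsGreatest
    (Set.range fun D : Divisor k F =>
      D.degree - (Module.finrank k (riemannRochSpace D) : ℤ) + 1) g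

end Genus

section Extensions

variable {k K L : Type*} [Field k] [Field K] [Field L] [Algebra k K] [Algebra k L] [Algebra K L]

/-- The place `P` of `L` lies above the place `p` of `K`. -/
def Place.LiesOver (P : Place k L) (p : Place k K) : Prop :=
  P.ring.comap (algebraMap K L) = p.ring

variable (K) in
/-- The inclusion of `𝒪_P ∩ K` into `𝒪_P`. -/
def Place.restrictHom (P : Place k L) : P.ring.comap (algebraMap K L) →+* P.ring :=
  (algebraMap K L).restrict (P.ring.comap (algebraMap K L)) P.ring fun _ hx => hx

variable (K) in
/-- The ramification index over `K` of a place `P` of `L`, that is, of the maximal ideal of `𝒪_P`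
over `𝒪_P ∩ K`. -/
noncomputable def Place.ramificationIdx (P : Place k L) : ℕ :=
  letI := (P.restrictHom K).toAlgebra
  (maximalIdeal P.ring).ramificationIdx (P.ring.comap (algebraMap K L))

variable (L) in
/-- The place `p` of `K` is totally ramified in `L / K`: some place of `L` above it has
ramification index `[L : K]`. -/
def Place.IsTotallyRamifiedIn (p : Place k K) : Prop :=
  ∃ P : Place k L, P.LiesOver p ∧ P.ramificationIdx K = Module.finrank K L

variable (L) in
/-- The place `p` of `K` splits (completely) in `L / K`: there are `[L : K]` places of `L`
above it. -/
def Place.SplitsIn (p : Place k K) : Prop :=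
  {P : Place k L | P.LiesOver p}.ncard = Module.finrank K L

variable (k K L) in
/-- A cubic extension of function fields over `k`: a separable extension of degree three which is
geometric, i.e. not of the form `K ℓ` with `ℓ` an extension of `k` of degree three. -/
structure IsCubicExtension : Prop where
  finrank_eq : Module.finrank K L = 3
  separable : Algebra.IsSeparable K L
  geometric : ¬ ∃ ℓ : IntermediateField k L,
    Module.finrank k ℓ = 3 ∧ IntermediateField.adjoin K (ℓ : Set L) = ⊤

variable (K L) in
/-- `L / K` is generated by an element with minimal polynomial `X ^ 3 - β`, `β ∈ K`. -/
def IsPurelyCubic : Prop :=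
  ∃ (y : L) (β : K), IntermediateField.adjoin K {y} = ⊤ ∧
    minpoly K y = Polynomial.X ^ 3 - Polynomial.C β

end Extensions

/-- For extensions `L` and `K'` of `K` inside `Ω`: `K'` is the purely cubic closure of `L / K`,
i.e. the smallest extension `M` of `K` such that `L M / M` is purely cubic. -/
def IsPurelyCubicClosure {K Ω : Type*} [Field K] [Field Ω] [Algebra K Ω]
    (L K' : IntermediateField K Ω) : Prop :=
  IsLeast {M : IntermediateField K Ω | IsPurelyCubic M
    (IntermediateField.extendScalars (le_sup_right : M ≤ L ⊔ M))} K'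

end FunctionFieldPlaces

/-!
Throughout, places are valuation rings, ramification is read off from the groups of values, and
cubic extensions are generated by Cardano's formula: with `u * v = a` in `K` and `u ^ 3`, `v ^ 3`
the roots in `K'` of a quadratic polynomial over `K`, the element `u + v` is a root of
`X ^ 3 - 3 a X - b`.

If `K'` is the purely cubic closure of `L / K`, then `L` arises in this way
(`IsPurelyCubicClosure.exists_cardano`), and minimality of `K'` means that `β = u ^ 3` generates it.
In particular `K' / K` is separable, and its conjugation `σ` carries `β` to `v ^ 3`. If only one
place of `K'` lies above `p`, then `σ β / β` is a unit there; since `β * σ β = a ^ 3`, this unit is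
`β` divided by a cube, so `L K'` is generated over `K'` by a cube root of a unit and value groups
are unchanged, as the characteristic is not three (`exists_valuation_eq_of_simple_root`). As value
groups do not acquire cube roots in the quadratic extension `K'`
(`exists_valuation_eq_of_pow_three`), `p` is not totally ramified in `L`
(`Place.ramificationIdx_ne_three`).

Conversely, let every `p` in `T` split. The two places above `p` are conjugate, hence of equal
degree over the field of constants, and in genus zero their difference is the divisor of a function
(`HasGenus.exists_valuation_eq`). With `γ` the product of these functions over `T`, the radicands
`γ ^ 2 * σ γ` and `γ * σ γ ^ 2` have product the cube of the norm of `γ`, and Cardano's formula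
yields `L`. At the points of `T`, the coefficient `b` has a simple pole while `a` is a unit, which
forces total ramification (`Place.ramificationIdx_eq_three_of_root`); elsewhere the radicands are
units. Total ramification at some place also shows that `L` is not a constant extension, because
these are unramified over a perfect field. The extension `K' / K` is separable because a place has
only one extension to a purely inseparable extension.

That places of function fields are discrete with finite residue fields, and that the values of an
algebraic element are torsion modulo those of the base field, comes from independence arguments: in
a linear combination of elements whose values (or whose residues) are independent enough, the
largest term cannot cancel (`linearIndependent_of_valuation_ne`, `Place.finite_residueField`).
-/

namespace FunctionFieldPlaces

open Polynomial

/-! ### Values of algebraic elements -/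

section Independence

variable {F E Γ : Type*} [Field F] [Field E] [Algebra F E] [LinearOrderedCommGroupWithZero Γ]

/-- Elements whose values are pairwise distinct modulo the value group of the base field are
linearly independent: in a sum of terms of distinct values the largest term dominates. -/
theorem linearIndependent_of_valuation_ne {ι : Type*} (v : Valuation E Γ) (z : ι → E)
    (h0 : ∀ i, z i ≠ 0)
    (h : ∀ i j, i ≠ j → ∀ c : F, v (z i) ≠ v (algebraMap F E c * z j)) :
    LinearIndependent F z := by
  classical
  rw [linearIndependent_iff']
  intro s g hsum i hi
  by_contra hgi
  obtain ⟨j, hj, hmax⟩ := (s.filter fun i => g i ≠ 0).exists_max_image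
    (fun i => v (g i • z i)) ⟨i, by simp [hi, hgi]⟩
  simp only [Finset.mem_filter] at hj hmax
  have hne : ∀ i, g i ≠ 0 → v (g i • z i) ≠ 0 := fun i hi => by
    rw [Valuation.ne_zero_iff]
    exact smul_ne_zero hi (h0 i)
  have key := v.map_sum_eq_of_lt (s := s) (f := fun i => g i • z i) hj.1 (fun i hi => by
    simp only [Finset.mem_sdiff, Finset.mem_singleton] at hi
    by_cases hgi : g i = 0
    · simp only [hgi, zero_smul, map_zero]
      exact zero_lt_iff.mpr (hne j hj.2)
    · refine lt_of_le_of_ne (hmax i ⟨hi.1, hgi⟩) fun heq => h i j hi.2 ((g i)⁻¹ * g j) ?_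
      rw [map_mul (algebraMap F E), mul_assoc, ← Algebra.smul_def (g j), map_mul, ← heq, ← map_mul,
        Algebra.smul_def (g i), ← mul_assoc, ← map_mul (algebraMap F E), inv_mul_cancel₀ hgi,
        map_one, one_mul])
  rw [hsum, map_zero] at key
  exact hne j hj.2 key.symm

/-- The value of an element of degree `n` has a positive multiple by at most `n` among the values
of the base field. -/
theorem exists_valuation_pow_eq (v : Valuation E Γ) {x : E} (hx : IsIntegral F x) :
    ∃ m, 1 ≤ m ∧ m ≤ (minpoly F x).natDegree ∧ ∃ c : F, v x ^ m = v (algebraMap F E c) := by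
  set n := (minpoly F x).natDegree with hn
  rcases eq_or_ne x 0 with rfl | hx0
  · exact ⟨1, le_rfl, minpoly.natDegree_pos hx, 0, by simp⟩
  by_contra! hcon
  have key : ∀ i j : ℕ, i < j → j ≤ n → ∀ c : F, v (x ^ j) ≠ v (algebraMap F E c * x ^ i) := by
    intro i j hij hj c hc
    refine hcon (j - i) (by omega) (by omega) c ?_
    have hxi : v (x ^ i) ≠ 0 := by simpa using fun h => absurd h hx0
    rw [← map_pow]
    refine mul_right_cancel₀ hxi ?_
    rw [← map_mul, ← pow_add, Nat.sub_add_cancel hij.le, hc, map_mul]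
  have hli : LinearIndependent F (fun i : Fin (n + 1) => x ^ (i : ℕ)) := by
    refine linearIndependent_of_valuation_ne v _ (fun i => pow_ne_zero _ hx0) fun i j hij c hc => ?_
    rcases lt_or_gt_of_ne (fun h => hij (Fin.ext h) : (i : ℕ) ≠ j) with h | h
    · have hc0 : c ≠ 0 := by
        rintro rfl
        simp [hx0] at hc
      refine key i j h (by omega) c⁻¹ ?_
      rw [map_mul, hc, ← map_mul, ← mul_assoc, ← map_mul, inv_mul_cancel₀ hc0, map_one, one_mul]
    · exact key j i h (by omega) c hc
  rw [Fintype.linearIndependent_iff] at hli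
  have h1 := hli (fun i => (minpoly F x).coeff i) (by
    have := minpoly.aeval F x
    rw [aeval_eq_sum_range, Finset.sum_range] at this
    exact this) (Fin.last n)
  have h2 := minpoly.monic hx
  rw [Monic, leadingCoeff] at h2
  simp [← hn] at h1 h2
  exact one_ne_zero (h2.symm.trans h1)

/-- In an extension of degree at most two, value groups do not acquire cube roots. -/
theorem exists_valuation_eq_of_pow_three (v : Valuation E Γ) {x : E} (hx : IsIntegral F x)
    (hdeg : (minpoly F x).natDegree ≤ 2) {c : F} (hc : v x ^ 3 = v (algebraMap F E c)) :
    ∃ d : F, v x = v (algebraMap F E d) := by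
  obtain ⟨m, h1, h2, d, hd⟩ := exists_valuation_pow_eq v hx
  rcases eq_or_ne x 0 with rfl | hx0
  · exact ⟨0, by simp⟩
  have hv : v x ≠ 0 := by simpa using hx0
  obtain rfl | rfl : m = 1 ∨ m = 2 := by omega
  · exact ⟨d, by simpa using hd⟩
  · refine ⟨c / d, ?_⟩
    rw [map_div₀, map_div₀, ← hc, ← hd]
    field_simp

end Independence

/-! ### Value groups under the adjunction of simple roots -/

section Unramified

variable {F E : Type*} [Field F] [Field E] [Algebra F E]

/-- The residue step: if `u` is a simple root modulo the maximal ideal of a polynomial over `A`,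
then an element of `A[u]` that lies in the maximal ideal of `B` is, up to a unit of `B`, the
product of the uniformizer of `A` and an element of `A[u]`. With `g` the minimal polynomial of the
residue of `u`, and `g * h` the reduction of `f`, the unit is the value at `u` of a lift of `h`. -/
theorem exists_valuation_eval₂_eq_mul {A B : Type*} [CommRing A] [IsLocalRing A] [CommRing B]
    [IsLocalRing B] (φ : A →+* B) [IsLocalHom φ] {ϖ : A} (hϖ : maximalIdeal A = Ideal.span {ϖ})
    {u : B} {f : A[X]} (hf : f.eval₂ φ u = 0) (hf' : IsUnit (f.derivative.eval₂ φ u))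
    {G : A[X]} (hG : G.eval₂ φ u ∈ maximalIdeal B) :
    ∃ (w : B) (G₁ : A[X]), IsUnit w ∧ w * G.eval₂ φ u = φ ϖ * G₁.eval₂ φ u := by
  let _ := (ResidueField.map φ).toAlgebra
  have hred : ∀ P : A[X], aeval (residue B u) (P.map (residue A)) = residue B (P.eval₂ φ u) := by
    intro P
    rw [aeval_def, eval₂_map, hom_eval₂]
    rfl
  have hfbar : aeval (residue B u) (f.map (residue A)) = 0 := by rw [hred, hf, map_zero]
  have hGbar : aeval (residue B u) (G.map (residue A)) = 0 := by
    rw [hred]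
    exact (residue_eq_zero_iff _).mpr hG
  have hf'bar : aeval (residue B u) (f.map (residue A)).derivative ≠ 0 := by
    rw [derivative_map, hred, residue_ne_zero_iff_isUnit]
    exact hf'
  obtain ⟨h, hh⟩ := minpoly.dvd _ _ hfbar
  obtain ⟨q, hq⟩ := minpoly.dvd _ _ hGbar
  have hhu : aeval (residue B u) h ≠ 0 := by
    intro h0
    apply hf'bar
    rw [hh]
    simp [h0]
  obtain ⟨h, rfl⟩ := map_surjective _ residue_surjective h
  obtain ⟨q, rfl⟩ := map_surjective _ residue_surjective q
  rw [hred, residue_ne_zero_iff_isUnit] at hhu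
  have hdiff : (h * G - f * q).map (residue A) = 0 := by
    rw [Polynomial.map_sub, Polynomial.map_mul, Polynomial.map_mul, hh, hq]
    ring
  have hdvd : C ϖ ∣ h * G - f * q := by
    rw [C_dvd_iff_dvd_coeff]
    intro i
    rw [← Ideal.mem_span_singleton, ← hϖ, ← residue_eq_zero_iff, ← coeff_map, hdiff, coeff_zero]
  obtain ⟨G₁, hG₁⟩ := hdvd
  refine ⟨_, G₁, hhu, ?_⟩
  have := congrArg (eval₂ φ u) hG₁
  simpa [eval₂_sub, eval₂_mul, hf] using this

/-- The map from a valuation ring to one above it. -/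
def _root_.ValuationSubring.restrictHom {A : ValuationSubring F} {B : ValuationSubring E}
    (hA : B.comap (algebraMap F E) = A) : A →+* B :=
  (algebraMap F E).restrict A B fun _ hx => by rwa [← hA] at hx

instance isLocalHom_restrictHom {A : ValuationSubring F} {B : ValuationSubring E}
    (hA : B.comap (algebraMap F E) = A) : IsLocalHom (ValuationSubring.restrictHom hA) where
  map_nonunit a ha := by
    rw [ValuationSubring.valuation_eq_one_iff] at ha
    have ha' : B.valuation (algebraMap F E a) = 1 := ha
    have ha0 : (a : F) ≠ 0 := by
      rintro h
      simp [h] at ha'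
    refine IsUnit.of_mul_eq_one ⟨(a : F)⁻¹, ?_⟩ (Subtype.ext (mul_inv_cancel₀ ha0))
    refine hA.le ?_
    rw [ValuationSubring.mem_comap, ← ValuationSubring.valuation_le_one_iff, map_inv₀, map_inv₀,
      ha', inv_one]

/-- The value group does not grow under the adjunction of an element that is modulo the maximal
ideal a simple root of a polynomial over the valuation ring. -/
theorem exists_valuation_eq_of_simple_root [Algebra.IsAlgebraic F E] {A : ValuationSubring F}
    {B : ValuationSubring E} (hA : B.comap (algebraMap F E) = A) [IsDiscreteValuationRing A]
    {u : E} (hu : u ∈ B) {f : A[X]} (hf : f.eval₂ ((algebraMap F E).comp A.subtype) u = 0)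
    (hf' : B.valuation (f.derivative.eval₂ ((algebraMap F E).comp A.subtype) u) = 1)
    {x : E} (hx : x ∈ IntermediateField.adjoin F {u}) :
    ∃ c : F, B.valuation x = B.valuation (algebraMap F E c) := by
  let φ : A →+* B := ValuationSubring.restrictHom hA
  have hφ : IsLocalHom φ := isLocalHom_restrictHom hA
  let b : B := ⟨u, hu⟩
  have heval : ∀ P : A[X], ((P.eval₂ φ b : B) : E) = P.eval₂ ((algebraMap F E).comp A.subtype) u :=
    fun P => hom_eval₂ P φ B.subtype b
  obtain ⟨ϖ, hϖ⟩ := IsDiscreteValuationRing.exists_irreducible A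
  let t : F := A.subtype ϖ
  have ht0 : t ≠ 0 := fun h => hϖ.ne_zero (Subtype.ext h)
  have hvt0 : B.valuation (algebraMap F E t) ≠ 0 := by simp [ht0]
  -- An element of `A[u]` of value at least that of `ϖ ^ n` has the value of a power of `ϖ`.
  have hpow : ∀ (n : ℕ) (G : A[X]),
      B.valuation (algebraMap F E t) ^ n ≤ B.valuation (G.eval₂ φ b : B) →
      ∃ j : ℕ, B.valuation (G.eval₂ φ b : B) = B.valuation (algebraMap F E t) ^ j := by
    intro n
    induction n with
    | zero =>
      intro G hG
      exact ⟨0, le_antisymm (by simp) hG⟩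
    | succ n ih =>
      intro G hG
      rcases B.valuation_lt_one_or_eq_one (G.eval₂ φ b) with hlt | heq
      · obtain ⟨w, G₁, hw, hG₁⟩ := exists_valuation_eval₂_eq_mul φ
          (hϖ.maximalIdeal_eq) (u := b) (f := f) (Subtype.ext (by rw [heval, hf]; rfl))
          (by rw [ValuationSubring.valuation_eq_one_iff, heval]; exact hf')
          ((B.valuation_lt_one_iff _).mpr hlt)
        have h1 := congrArg (fun z : B => B.valuation (z : E)) hG₁
        simp only [MulMemClass.coe_mul, map_mul] at h1
        rw [(B.valuation_eq_one_iff _).mp hw, one_mul] at h1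
        have h2 : B.valuation (φ ϖ : B) = B.valuation (algebraMap F E t) := rfl
        rw [h2] at h1
        rw [h1, pow_succ', mul_le_mul_iff_right₀ (zero_lt_iff.mpr hvt0)] at hG
        obtain ⟨j, hj⟩ := ih G₁ hG
        exact ⟨j + 1, by rw [h1, hj, pow_succ']⟩
      · exact ⟨0, by simpa using heq⟩
  have hgen : ∀ G : A[X], ∃ c : F,
      B.valuation (G.eval₂ φ b : B) = B.valuation (algebraMap F E c) := by
    intro G
    rcases eq_or_ne ((G.eval₂ φ b : B) : E) 0 with h0 | h0
    · exact ⟨0, by simp [h0]⟩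
    -- The value of `G(u)` is bounded below by a nonzero value from the base.
    obtain ⟨m, hm, -, c, hc⟩ := exists_valuation_pow_eq (F := F) B.valuation
      (Algebra.IsIntegral.isIntegral ((G.eval₂ φ b : B) : E))
    have hcle : B.valuation (algebraMap F E c) ≤ B.valuation ((G.eval₂ φ b : B) : E) := by
      rw [← hc]
      exact pow_le_of_le_one zero_le (B.valuation_le_one _) (by omega)
    have hcA : c ∈ A := by
      rw [← hA, ValuationSubring.mem_comap, ← ValuationSubring.valuation_le_one_iff]
      exact hcle.trans (B.valuation_le_one _)
    have hc0 : (⟨c, hcA⟩ : A) ≠ 0 := by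
      intro h
      have h' : c = 0 := congrArg Subtype.val h
      have : B.valuation ((G.eval₂ φ b : B) : E) ^ m ≠ 0 :=
        pow_ne_zero _ ((Valuation.ne_zero_iff _).mpr h0)
      exact this (by rw [hc, h', map_zero, map_zero])
    obtain ⟨n, w, hw⟩ := IsDiscreteValuationRing.eq_unit_mul_pow_irreducible hc0 hϖ
    have hcn : B.valuation (algebraMap F E c) = B.valuation (algebraMap F E t) ^ n := by
      have h1 : c = A.subtype w * t ^ n := congrArg Subtype.val hw
      have h2 := (B.valuation_eq_one_iff _).mp (w.isUnit.map φ)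
      have h3 : B.valuation (φ w : B) = B.valuation (algebraMap F E (A.subtype w)) := rfl
      rw [h1, map_mul, map_mul, ← h3, h2, one_mul, map_pow, map_pow]
    obtain ⟨j, hj⟩ := hpow n G (hcn ▸ hcle)
    exact ⟨t ^ j, by rw [hj, map_pow, map_pow]⟩
  have hpoly : ∀ G : F[X], ∃ c : F, B.valuation (aeval u G) = B.valuation (algebraMap F E c) := by
    intro G
    obtain ⟨d, hd', hd⟩ := IsLocalization.integerNormalization_spec (nonZeroDivisors A) G
    obtain ⟨c, hc⟩ := hgen (IsLocalization.integerNormalization (nonZeroDivisors A) G)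
    have hd0 : A.subtype d ≠ 0 := by
      exact fun h => nonZeroDivisors.ne_zero hd' (Subtype.ext h)
    have h1 : (((IsLocalization.integerNormalization (nonZeroDivisors A) G).eval₂ φ b : B) : E)
        = algebraMap F E (A.subtype d) * aeval u G := by
      rw [heval]
      have h := congrArg (aeval u) hd
      rwa [Algebra.smul_def, Polynomial.algebraMap_apply, map_mul, aeval_C, aeval_def,
        eval₂_map] at h
    refine ⟨c / A.subtype d, ?_⟩
    have hd1 : B.valuation (algebraMap F E (A.subtype d)) ≠ 0 := by
      rwa [Valuation.ne_zero_iff, _root_.map_ne_zero]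
    rw [map_div₀, map_div₀, ← hc, h1, map_mul, mul_div_cancel_left₀ _ hd1]
  rw [IntermediateField.mem_adjoin_simple_iff] at hx
  obtain ⟨r, s, rfl⟩ := hx
  obtain ⟨c, hc⟩ := hpoly r
  obtain ⟨d, hd⟩ := hpoly s
  exact ⟨c / d, by rw [map_div₀, map_div₀, map_div₀, hc, hd]⟩

end Unramified

/-! ### Places of function fields -/

section Extension

variable {F E : Type*} [Field F] [Field E] [Algebra F E]

/-- Valuation rings extend to arbitrary extension fields. -/
theorem exists_valuationSubring_comap_eq (E : Type*) [Field E] [Algebra F E]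
    (A : ValuationSubring F) : ∃ B : ValuationSubring E, B.comap (algebraMap F E) = A := by
  obtain ⟨B, h, hloc⟩ := IsLocalRing.exists_factor_valuationRing ((algebraMap F E).comp A.subtype)
  refine ⟨B, le_antisymm (fun x hx => ?_) fun x hx => h ⟨x, hx⟩⟩
  by_contra hxA
  have hx0 : x ≠ 0 := by
    rintro rfl
    exact hxA A.zero_mem
  have hinv : x⁻¹ ∈ A := (A.mem_or_inv_mem x).resolve_left hxA
  have hu : IsUnit (⟨x⁻¹, hinv⟩ : A) := by
    refine hloc.map_nonunit _ (IsUnit.of_mul_eq_one (⟨algebraMap F E x, hx⟩ : B.toSubring) ?_)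
    refine Subtype.ext ?_
    change algebraMap F E x⁻¹ * algebraMap F E x = 1
    rw [← map_mul, inv_mul_cancel₀ hx0, map_one]
  obtain ⟨y, hy⟩ := hu.exists_right_inv
  have h1 : x⁻¹ * (y : F) = 1 := congrArg Subtype.val hy
  rw [inv_mul_eq_one₀ hx0] at h1
  exact hxA (h1 ▸ y.2)

end Extension

section FunctionField

variable {k K : Type*} [Field k] [Field K] [Algebra k K]

/-- A function field is finite over the subfield generated by any transcendental element. -/
theorem IsFunctionField.finiteDimensional (hK : IsFunctionField k K) {t : K}
    (ht : Transcendental k t) : FiniteDimensional (IntermediateField.adjoin k {t}) K := by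
  obtain ⟨x, hx, hfin⟩ := hK
  have hfg : Algebra.EssFiniteType k K := by
    have : Algebra.EssFiniteType k (IntermediateField.adjoin k {x}) :=
      IntermediateField.essFiniteType_iff.mpr ⟨{x}, by simp⟩
    exact Algebra.EssFiniteType.comp k (IntermediateField.adjoin k {x}) K
  have htr : Algebra.trdeg k K ≤ 1 := by
    open scoped IntermediateField.algebraAdjoinAdjoin in
    have : Algebra.IsAlgebraic (Algebra.adjoin k {x}) K :=
      (IsFractionRing.comap_isAlgebraic_iff (K := IntermediateField.adjoin k {x})).mpr inferInstance
    simpa using Algebra.IsAlgebraic.trdeg_le_cardinalMk k ({x} : Set K)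
  have htb : IsTranscendenceBasis k (fun _ : Unit => t) :=
    ((algebraicIndependent_unique_type_iff (ι := Unit)).mpr
      ht).isTranscendenceBasis_of_lift_trdeg_le_of_finite (by simpa using htr)
  have halg := htb.isAlgebraic_field
  rw [Set.range_const] at halg
  have : Algebra.EssFiniteType (IntermediateField.adjoin k {t}) K :=
    Algebra.EssFiniteType.of_comp k _ K
  obtain ⟨s, hs⟩ := IntermediateField.fg_top (IntermediateField.adjoin k {t}) K
  have := IntermediateField.finiteDimensional_adjoin (K := IntermediateField.adjoin k {t})
    (S := (s : Set K)) fun x _ => Algebra.IsIntegral.isIntegral x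
  rw [hs] at this
  exact Module.Finite.equiv IntermediateField.topEquiv.toLinearEquiv

theorem IsFunctionField.of_finiteDimensional (hK : IsFunctionField k K) {L : Type*} [Field L]
    [Algebra k L] [Algebra K L] [IsScalarTower k K L] [FiniteDimensional K L] :
    IsFunctionField k L := by
  obtain ⟨x, hx, hfin⟩ := hK
  have hx' : Transcendental k (algebraMap K L x) :=
    (transcendental_algebraMap_iff (algebraMap K L).injective).mpr hx
  refine ⟨algebraMap K L x, hx', ?_⟩
  have hmem : ∀ y : IntermediateField.adjoin k {x},
      algebraMap K L y ∈ IntermediateField.adjoin k {algebraMap K L x} := by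
    intro y
    have h := IntermediateField.adjoin_map k {x} (IsScalarTower.toAlgHom k K L)
    rw [Set.image_singleton, IsScalarTower.coe_toAlgHom'] at h
    rw [← h]
    exact ⟨y, y.2, rfl⟩
  let f : IntermediateField.adjoin k {x} →+* IntermediateField.adjoin k {algebraMap K L x} :=
    ((algebraMap K L).comp (algebraMap (IntermediateField.adjoin k {x}) K)).codRestrict _ hmem
  let _ := f.toAlgebra
  have : IsScalarTower (IntermediateField.adjoin k {x})
      (IntermediateField.adjoin k {algebraMap K L x}) L :=
    IsScalarTower.of_algebraMap_eq fun _ => rfl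
  have : FiniteDimensional (IntermediateField.adjoin k {x}) L :=
    Module.Finite.trans K L
  exact Module.Finite.of_restrictScalars_finite (IntermediateField.adjoin k {x}) _ L

theorem Place.valuation_eq_one_of_isAlgebraic (P : Place k K) {y : K} (hy : IsAlgebraic k y)
    (h0 : y ≠ 0) : P.ring.valuation y = 1 := by
  have hmem : ∀ z : K, IsAlgebraic k z → P.ring.valuation z ≤ 1 := by
    intro z hz
    rw [ValuationSubring.valuation_le_one_iff]
    have h1 : IsIntegral P.ring z := by
      have := hz.isIntegral
      have hst : IsScalarTower k P.ring K := IsScalarTower.of_algebraMap_eq fun _ => rfl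
      exact this.tower_top
    obtain ⟨w, hw⟩ := IsIntegrallyClosed.isIntegral_iff.mp h1
    rw [← hw]
    exact w.2
  refine le_antisymm (hmem y hy) ?_
  have := hmem _ hy.inv
  rw [map_inv₀] at this
  rwa [inv_le_one₀ (zero_lt_iff.mpr ((Valuation.ne_zero_iff _).mpr h0))] at this

theorem Place.valuation_algebraMap (P : Place k K) {c : k} (hc : c ≠ 0) :
    P.ring.valuation (algebraMap k K c) = 1 :=
  P.valuation_eq_one_of_isAlgebraic (isAlgebraic_algebraMap c) (by simpa using hc)

theorem Place.valuation_algebraMap_le (P : Place k K) (c : k) :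
    P.ring.valuation (algebraMap k K c) ≤ 1 := by
  rw [ValuationSubring.valuation_le_one_iff]
  exact P.algebraMap_mem c

theorem Place.transcendental (P : Place k K) {t : K} (h0 : t ≠ 0) (ht : P.ring.valuation t < 1) :
    Transcendental k t := fun h => ht.ne (P.valuation_eq_one_of_isAlgebraic h h0)

/-- `w` is a unit at `P` whose residue lies in `k`. -/
def Place.HasConstantResidue (P : Place k K) (w : K) : Prop :=
  ∃ a : k, a ≠ 0 ∧ P.ring.valuation (w - algebraMap k K a) < 1

theorem Place.HasConstantResidue.valuation_eq_one {P : Place k K} {w : K}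
    (hw : P.HasConstantResidue w) : P.ring.valuation w = 1 := by
  obtain ⟨a, ha, h⟩ := hw
  rw [← P.valuation_algebraMap ha] at h ⊢
  exact Valuation.map_eq_of_sub_lt _ h

theorem Place.HasConstantResidue.div {P : Place k K} {w z : K}
    (hw : P.HasConstantResidue w) (hz : P.HasConstantResidue z) : P.HasConstantResidue (w / z) := by
  have hz1 := hz.valuation_eq_one
  obtain ⟨a, ha, h⟩ := hw
  obtain ⟨b, hb, h'⟩ := hz
  have hb0 : algebraMap k K b ≠ 0 := by simpa using hb
  have hz0 : z ≠ 0 := by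
    rintro rfl
    simp at hz1
  refine ⟨a / b, div_ne_zero ha hb, ?_⟩
  have : w / z - algebraMap k K (a / b) = ((w - algebraMap k K a) * algebraMap k K b
      - algebraMap k K a * (z - algebraMap k K b)) / (z * algebraMap k K b) := by
    rw [map_div₀]
    field_simp
    ring
  rw [this, map_div₀, map_mul _ z, hz1, P.valuation_algebraMap hb, mul_one, div_one]
  refine Valuation.map_sub_lt _ ?_ ?_
  · rwa [map_mul, P.valuation_algebraMap hb, mul_one]
  · rwa [map_mul, P.valuation_algebraMap ha, one_mul]

/-- Every element of `k(t)`, for `t` in the maximal ideal of a place, is a power of `t` times a unit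
with residue in `k`. -/
theorem Place.exists_eq_zpow_mul (P : Place k K) {t : K} (h0 : t ≠ 0)
    (ht : P.ring.valuation t < 1) {c : K} (hc : c ∈ IntermediateField.adjoin k {t}) (hc0 : c ≠ 0) :
    ∃ (n : ℤ) (w : K), P.HasConstantResidue w ∧ c = t ^ n * w := by
  have hpoly : ∀ p : k[X], p ≠ 0 →
      ∃ (n : ℕ) (w : K), P.HasConstantResidue w ∧ aeval t p = t ^ n * w := by
    intro p hp
    obtain ⟨q, hq, hdvd⟩ := exists_eq_pow_rootMultiplicity_mul_and_not_dvd p hp 0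
    rw [C_0, sub_zero] at hq hdvd
    refine ⟨p.rootMultiplicity 0, aeval t q, ⟨q.coeff 0, fun h => hdvd (X_dvd_iff.mpr h), ?_⟩, ?_⟩
    · have h1 : aeval t q - algebraMap k K (q.coeff 0) = aeval t q.divX * t := by
        conv_lhs => rw [← divX_mul_X_add q]
        simp
      rw [h1, map_mul]
      refine mul_lt_one_of_nonneg_of_lt_one_right ?_ zero_le ht
      rw [aeval_eq_sum_range]
      refine Valuation.map_sum_le _ fun i _ => ?_
      rw [Algebra.smul_def, map_mul, map_pow]
      exact mul_le_one₀ (P.valuation_algebraMap_le _) zero_le (pow_le_one' ht.le _)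
    · conv_lhs => rw [hq]
      simp
  rw [IntermediateField.mem_adjoin_simple_iff] at hc
  obtain ⟨r, s, rfl⟩ := hc
  obtain ⟨n, w, hw, hr⟩ := hpoly r (by rintro rfl; simp at hc0)
  obtain ⟨m, z, hz, hs⟩ := hpoly s (by rintro rfl; simp at hc0)
  refine ⟨n - m, w / z, hw.div hz, ?_⟩
  rw [hr, hs, zpow_sub₀ h0, zpow_natCast, zpow_natCast]
  ring

/-- In a function field, only finitely many values lie between that of `t` and `1`: elements with
distinct such values are linearly independent over `k(t)`. -/
theorem Place.finite_values (hK : IsFunctionField k K) (P : Place k K) {t : K} (h0 : t ≠ 0)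
    (ht : P.ring.valuation t < 1) :
    {γ | P.ring.valuation t < γ ∧ γ ≤ 1}.Finite := by
  have := hK.finiteDimensional (P.transcendental h0 ht)
  choose z hz using P.ring.valuation_surjective
  have hpos : 0 < P.ring.valuation t := zero_lt_iff.mpr ((Valuation.ne_zero_iff _).mpr h0)
  have hli : LinearIndependent (IntermediateField.adjoin k {t})
      (fun γ : {γ | P.ring.valuation t < γ ∧ γ ≤ 1} => z γ) := by
    refine linearIndependent_of_valuation_ne P.ring.valuation _ (fun γ h => ?_)
      fun γ δ hne c hc => ?_
    · have h1 := hz γ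
      rw [h, map_zero] at h1
      exact absurd γ.2.1 (by rw [← h1]; exact not_lt_zero)
    · rw [map_mul, hz, hz] at hc
      have hc0 : (c : K) ≠ 0 := by
        intro h
        have h1 : (algebraMap (IntermediateField.adjoin k {t}) K) c = 0 := h
        rw [h1, map_zero, zero_mul] at hc
        exact absurd γ.2.1 (by rw [hc]; exact not_lt_zero)
      obtain ⟨n, w, hw, hcw⟩ := P.exists_eq_zpow_mul h0 ht c.2 hc0
      have hv : P.ring.valuation (algebraMap (IntermediateField.adjoin k {t}) K c) =
          P.ring.valuation t ^ n := by
        change P.ring.valuation (c : K) = _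
        rw [hcw, map_mul, hw.valuation_eq_one, mul_one, map_zpow₀]
      rw [hv] at hc
      obtain hn | rfl | hn := lt_trichotomy n 0
      · have h1 : (P.ring.valuation t)⁻¹ ≤ P.ring.valuation t ^ n := by
          rw [← zpow_neg_one]
          exact zpow_le_zpow_right_of_le_one₀ hpos ht.le (by omega)
        have h2 : 1 < P.ring.valuation t ^ n * δ :=
          calc (1 : P.ring.ValueGroup) = (P.ring.valuation t)⁻¹ * P.ring.valuation t :=
                (inv_mul_cancel₀ hpos.ne').symm
            _ < (P.ring.valuation t)⁻¹ * δ := by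
                rw [mul_lt_mul_iff_right₀ (inv_pos.mpr hpos)]
                exact δ.2.1
            _ ≤ _ := by gcongr
        exact absurd γ.2.2 (by rw [hc]; exact not_le.mpr h2)
      · rw [zpow_zero, one_mul] at hc
        exact hne (Subtype.ext hc)
      · have h1 : P.ring.valuation t ^ n ≤ P.ring.valuation t := by
          conv_rhs => rw [← zpow_one (P.ring.valuation t)]
          exact zpow_le_zpow_right_of_le_one₀ hpos ht.le (by omega)
        exact absurd γ.2.1 (by
          rw [hc]
          exact not_lt.mpr ((mul_le_of_le_one_right zero_le δ.2.2).trans h1))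
  exact hli.finite

theorem Place.exists_ne_zero_valuation_lt_one (P : Place k K) :
    ∃ t : K, t ≠ 0 ∧ P.ring.valuation t < 1 := by
  by_contra! h
  refine P.ne_top (eq_top_iff.mpr fun x _ => ?_)
  rcases eq_or_ne x 0 with rfl | hx
  · exact P.ring.zero_mem
  · have := h x⁻¹ (inv_ne_zero hx)
    rw [map_inv₀, one_le_inv₀ (zero_lt_iff.mpr ((Valuation.ne_zero_iff _).mpr hx))] at this
    rwa [← ValuationSubring.valuation_le_one_iff]

/-- The places of a function field are discrete. -/
theorem Place.isDiscreteValuationRing (hK : IsFunctionField k K) (P : Place k K) :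
    IsDiscreteValuationRing P.ring := by
  obtain ⟨t, ht0, ht⟩ := P.exists_ne_zero_valuation_lt_one
  -- A uniformizer is an element of maximal value below `1`.
  obtain ⟨ϖ, hϖ0, hϖ, hmax⟩ : ∃ ϖ : K, ϖ ≠ 0 ∧ P.ring.valuation ϖ < 1 ∧
      ∀ z, P.ring.valuation z < 1 → P.ring.valuation z ≤ P.ring.valuation ϖ := by
    have hfin : {γ | P.ring.valuation t < γ ∧ γ < 1}.Finite :=
      (P.finite_values hK ht0 ht).subset fun γ h => ⟨h.1, h.2.le⟩
    rcases Set.eq_empty_or_nonempty {γ | P.ring.valuation t < γ ∧ γ < 1} with he | hne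
    · refine ⟨t, ht0, ht, fun z hz => ?_⟩
      by_contra! hlt
      exact (Set.eq_empty_iff_forall_notMem.mp he) _ ⟨hlt, hz⟩
    · obtain ⟨γ, hγ, hm⟩ := hfin.exists_maximal hne
      obtain ⟨ϖ, rfl⟩ := P.ring.valuation_surjective γ
      refine ⟨ϖ, ?_, hγ.2, fun z hz => ?_⟩
      · rintro rfl
        exact absurd hγ.1 (by simp)
      · rcases le_or_gt (P.ring.valuation z) (P.ring.valuation t) with h | h
        · exact h.trans hγ.1.le
        · by_contra! hlt
          exact hlt.not_ge (hm ⟨h, hz⟩ hlt.le)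
  have hpos : 0 < P.ring.valuation ϖ := zero_lt_iff.mpr ((Valuation.ne_zero_iff _).mpr hϖ0)
  have hmem : ϖ ∈ P.ring := by
    rw [← ValuationSubring.valuation_le_one_iff]
    exact hϖ.le
  -- Every nonzero `x` has the value of a power of the uniformizer.
  have hval : ∀ x : K, x ≠ 0 → P.ring.valuation x ≤ 1 →
      ∃ n : ℕ, P.ring.valuation x = P.ring.valuation ϖ ^ n := by
    intro x hx hx1
    rcases hx1.eq_or_lt with h1 | hlt
    · exact ⟨0, by rw [h1, pow_zero]⟩
    obtain ⟨n, hn⟩ : ∃ n : ℕ, P.ring.valuation ϖ ^ n ≤ P.ring.valuation x := by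
      by_contra! hcon
      refine Set.infinite_of_injective_forall_mem (f := fun n : ℕ => P.ring.valuation ϖ ^ n)
        (pow_right_strictAnti₀ hpos hϖ).injective (fun n => ?_) (P.finite_values hK hx hlt)
      exact ⟨hcon n, pow_le_one₀ zero_le hϖ.le⟩
    classical
    have hfind := Nat.find_spec (⟨n, hn⟩ : ∃ n : ℕ, P.ring.valuation ϖ ^ n ≤ P.ring.valuation x)
    set m := Nat.find (⟨n, hn⟩ : ∃ n : ℕ, P.ring.valuation ϖ ^ n ≤ P.ring.valuation x) with hm
    refine ⟨m, le_antisymm ?_ hfind⟩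
    rcases Nat.eq_zero_or_pos m with h0 | h0
    · rw [h0, pow_zero]
      exact hx1
    · have h1 : P.ring.valuation x < P.ring.valuation ϖ ^ (m - 1) :=
        not_le.mp (Nat.find_min _ (Nat.sub_lt h0 one_pos))
      have h2 := hmax (x / ϖ ^ (m - 1)) (by
        rw [map_div₀, map_pow]
        exact (div_lt_one₀ (pow_pos hpos _)).mpr h1)
      rw [map_div₀, map_pow, div_le_iff₀ (pow_pos hpos _), ← pow_succ'] at h2
      rwa [Nat.sub_add_cancel h0] at h2
  refine IsDiscreteValuationRing.ofHasUnitMulPowIrreducibleFactorization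
    ⟨⟨ϖ, hmem⟩, ⟨?_, ?_⟩, fun {x} hx => ?_⟩
  · rw [ValuationSubring.valuation_eq_one_iff]
    exact hϖ.ne
  · intro a b hab
    rw [ValuationSubring.valuation_eq_one_iff, ValuationSubring.valuation_eq_one_iff]
    by_contra! hcon
    have ha := hmax a (lt_of_le_of_ne (P.ring.valuation_le_one a) hcon.1)
    have hb := lt_of_le_of_ne (P.ring.valuation_le_one b) hcon.2
    have h1 : P.ring.valuation ϖ = P.ring.valuation a * P.ring.valuation b := by
      rw [← map_mul]
      exact congrArg P.ring.valuation (congrArg Subtype.val hab)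
    have h2 : P.ring.valuation ϖ < P.ring.valuation ϖ :=
      calc P.ring.valuation ϖ = P.ring.valuation a * P.ring.valuation b := h1
        _ ≤ P.ring.valuation ϖ * P.ring.valuation b := by gcongr
        _ < P.ring.valuation ϖ := mul_lt_of_lt_one_right hpos hb
    exact lt_irrefl _ h2
  · obtain ⟨n, hn⟩ := hval x (fun h => hx (Subtype.ext h)) (P.ring.valuation_le_one x)
    have h1 := hn
    rw [← map_pow, ValuationSubring.valuation_eq_iff] at h1
    obtain ⟨a, ha⟩ := h1
    refine ⟨n, a, Subtype.ext ?_⟩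
    rw [mul_comm]
    exact ha

/-- The residue fields of the places of a function field are finite over the base: representatives
of residues that are independent over `k` are independent over `k(t)`, for `t` in the maximal
ideal. -/
theorem Place.finite_residueField (hK : IsFunctionField k K) (P : Place k K) :
    Module.Finite k (ResidueField P.ring) := by
  obtain ⟨t, h0, ht⟩ := P.exists_ne_zero_valuation_lt_one
  have hfd := hK.finiteDimensional (P.transcendental h0 ht)
  let e := Module.Basis.ofVectorSpace k (ResidueField P.ring)
  choose z hz using residue_surjective (R := P.ring)
  have hli : LinearIndependent (IntermediateField.adjoin k {t}) (fun i => (z (e i) : K)) := by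
    classical
    rw [linearIndependent_iff']
    intro s g hsum i hi
    by_contra hgi
    obtain ⟨j, hj, hmax⟩ := s.exists_max_image (fun i => P.ring.valuation (g i : K)) ⟨i, hi⟩
    have hgj : (g j : K) ≠ 0 := by
      intro h
      have := hmax i hi
      rw [h, map_zero, le_zero_iff, Valuation.zero_iff] at this
      exact hgi (Subtype.ext this)
    have hpos : 0 < P.ring.valuation (g j : K) :=
      zero_lt_iff.mpr ((Valuation.ne_zero_iff _).mpr hgj)
    -- After division by the largest coefficient, all coefficients have residues in `k`.
    have hres : ∀ i, ∃ a : k, i ∈ s →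
        P.ring.valuation ((g i / g j : K) - algebraMap k K a) < 1 := by
      intro i
      by_cases hi : i ∈ s
      · by_cases hg : (g i : K) = 0
        · exact ⟨0, fun _ => by simp [hg]⟩
        · obtain ⟨n, w, hw, hcw⟩ := P.exists_eq_zpow_mul h0 ht
            (div_mem (g i).2 (g j).2) (div_ne_zero hg hgj)
          have hle : P.ring.valuation (g i / g j : K) ≤ 1 := by
            rw [map_div₀]
            exact (div_le_one₀ hpos).mpr (hmax i hi)
          have hvt : 0 < P.ring.valuation t := zero_lt_iff.mpr ((Valuation.ne_zero_iff _).mpr h0)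
          rw [hcw, map_mul, hw.valuation_eq_one, mul_one, map_zpow₀] at hle
          obtain hn | rfl | hn := lt_trichotomy n 0
          · exact absurd hle (not_le.mpr (one_lt_zpow_of_neg₀ hvt ht hn))
          · obtain ⟨a, -, ha⟩ := hw
            exact ⟨a, fun _ => by rwa [hcw, zpow_zero, one_mul]⟩
          · refine ⟨0, fun _ => ?_⟩
            rw [map_zero, sub_zero, hcw, map_mul, hw.valuation_eq_one, mul_one, map_zpow₀]
            exact zpow_lt_one₀ hvt ht hn
      · exact ⟨0, fun h => absurd h hi⟩
    choose a ha using hres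
    have hsum' : ∑ i ∈ s, a i • e i = 0 := by
      have h1 : P.ring.valuation
          (∑ i ∈ s, ((g i / g j : K) - algebraMap k K (a i)) * z (e i)) < 1 := by
        refine Valuation.map_sum_lt _ one_ne_zero fun i hi => ?_
        rw [map_mul]
        exact mul_lt_one_of_nonneg_of_lt_one_left zero_le (ha i hi) (P.ring.valuation_le_one _)
      have h2 : ∑ i ∈ s, ((g i / g j : K) - algebraMap k K (a i)) * z (e i) =
          -((∑ i ∈ s, algebraMap k P.ring (a i) * z (e i) : P.ring) : K) := by
        have h3 : ∑ i ∈ s, (g i / g j : K) * z (e i) = 0 := by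
          have h4 : ∑ i ∈ s, (g i : K) * z (e i) = 0 := hsum
          simp_rw [div_mul_eq_mul_div]
          rw [← Finset.sum_div, h4, zero_div]
        simp_rw [sub_mul]
        rw [Finset.sum_sub_distrib, h3, zero_sub]
        push_cast
        rfl
      rw [h2, Valuation.map_neg, ← ValuationSubring.valuation_lt_one_iff,
        ← residue_eq_zero_iff, map_sum] at h1
      rw [← h1]
      refine Finset.sum_congr rfl fun i _ => ?_
      rw [map_mul, hz, Algebra.smul_def]
      rfl
    have haj := linearIndependent_iff'.mp e.linearIndependent s a hsum' j hj
    have h1 := ha j hj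
    rw [haj, div_self hgj, map_zero, sub_zero, map_one] at h1
    exact lt_irrefl _ h1
  have := hli.finite
  exact Module.Finite.of_basis e

end FunctionField

/-! ### Ramification indices and values -/

section Ramification

variable {F E : Type*} [Field F] [Field E] [Algebra F E]

theorem valuation_le_iff_of_comap_eq {A : ValuationSubring F} {B : ValuationSubring E}
    (h : B.comap (algebraMap F E) = A) (x y : F) :
    B.valuation (algebraMap F E x) ≤ B.valuation (algebraMap F E y) ↔
      A.valuation x ≤ A.valuation y := by
  rcases eq_or_ne y 0 with rfl | hy
  · simp
  · have h1 := zero_lt_iff.mpr ((Valuation.ne_zero_iff A.valuation).mpr hy)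
    have h2 := zero_lt_iff.mpr ((Valuation.ne_zero_iff B.valuation).mpr
      ((map_ne_zero (algebraMap F E)).mpr hy))
    rw [← div_le_one₀ h1, ← div_le_one₀ h2, ← map_div₀, ← map_div₀, ← map_div₀,
      ValuationSubring.valuation_le_one_iff, ValuationSubring.valuation_le_one_iff, ← h,
      ValuationSubring.mem_comap]

theorem valuation_lt_iff_of_comap_eq {A : ValuationSubring F} {B : ValuationSubring E}
    (h : B.comap (algebraMap F E) = A) (x y : F) :
    B.valuation (algebraMap F E x) < B.valuation (algebraMap F E y) ↔
      A.valuation x < A.valuation y := by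
  rw [← not_le, valuation_le_iff_of_comap_eq h, not_le]

theorem valuation_eq_iff_of_comap_eq {A : ValuationSubring F} {B : ValuationSubring E}
    (h : B.comap (algebraMap F E) = A) (x y : F) :
    B.valuation (algebraMap F E x) = B.valuation (algebraMap F E y) ↔
      A.valuation x = A.valuation y := by
  rw [le_antisymm_iff, le_antisymm_iff, valuation_le_iff_of_comap_eq h,
    valuation_le_iff_of_comap_eq h]

theorem _root_.ValuationSubring.mem_span_singleton_iff (B : ValuationSubring E) (x y : B) :
    x ∈ Ideal.span {y} ↔ B.valuation x ≤ B.valuation y := by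
  rw [Ideal.mem_span_singleton', ValuationSubring.valuation_le_iff]
  simp [Subtype.ext_iff]

theorem _root_.ValuationSubring.maximalIdeal_eq_span_iff (B : ValuationSubring E) (ϖ : B) :
    maximalIdeal B = Ideal.span {ϖ} ↔
      B.valuation ϖ < 1 ∧ ∀ x : E, B.valuation x < 1 → B.valuation x ≤ B.valuation ϖ := by
  constructor
  · intro h
    refine ⟨?_, fun x hx => ?_⟩
    · rw [← ValuationSubring.valuation_lt_one_iff, h]
      exact Ideal.mem_span_singleton_self ϖ
    · have hx' : x ∈ B := (B.valuation_le_one_iff x).mp hx.le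
      have : (⟨x, hx'⟩ : B) ∈ Ideal.span {ϖ} := by
        rw [← h, ValuationSubring.valuation_lt_one_iff]
        exact hx
      exact (B.mem_span_singleton_iff _ _).mp this
  · rintro ⟨h1, h2⟩
    ext x
    rw [ValuationSubring.valuation_lt_one_iff, ValuationSubring.mem_span_singleton_iff]
    exact ⟨h2 x, fun h => h.trans_lt h1⟩

/-- A uniformizer of a discrete valuation ring, as an element of the field. -/
theorem _root_.ValuationSubring.exists_uniformizer (B : ValuationSubring E)
    [IsDiscreteValuationRing B] :
    ∃ ϖ : B, maximalIdeal B = Ideal.span {ϖ} ∧ (ϖ : E) ≠ 0 := by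
  obtain ⟨ϖ, hϖ⟩ := IsDiscreteValuationRing.exists_irreducible B
  exact ⟨ϖ, hϖ.maximalIdeal_eq, fun h => hϖ.ne_zero (Subtype.ext h)⟩

theorem _root_.ValuationSubring.exists_valuation_eq_pow (B : ValuationSubring E)
    [IsDiscreteValuationRing B] {ϖ : B} (hϖ : maximalIdeal B = Ideal.span {ϖ}) {x : E}
    (hx0 : x ≠ 0) (hx : B.valuation x ≤ 1) : ∃ n : ℕ, B.valuation x = B.valuation ϖ ^ n := by
  have hirr := (IsDiscreteValuationRing.irreducible_iff_uniformizer ϖ).mpr hϖ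
  have hxB : x ∈ B := (B.valuation_le_one_iff x).mp hx
  obtain ⟨n, u, hu⟩ := IsDiscreteValuationRing.eq_unit_mul_pow_irreducible
    (x := (⟨x, hxB⟩ : B)) (fun h => hx0 (congrArg Subtype.val h)) hirr
  refine ⟨n, ?_⟩
  have h1 : x = (u : B) * (ϖ : E) ^ n := congrArg Subtype.val hu
  rw [h1, map_mul, B.valuation_unit, one_mul, map_pow]

variable {k K L : Type*} [Field k] [Field K] [Field L] [Algebra k K] [Algebra k L] [Algebra K L]

/-- If a uniformizer of the place below has the value of the `e`-th power of a uniformizer, then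
the ramification index is `e`. -/
theorem Place.ramificationIdx_eq {P : Place k L} {p : Place k K} (hPp : P.LiesOver p)
    [IsDiscreteValuationRing P.ring] {t : p.ring} (ht : maximalIdeal p.ring = Ideal.span {t})
    (ht0 : (t : K) ≠ 0) {s : P.ring} (hs : maximalIdeal P.ring = Ideal.span {s}) {e : ℕ}
    (he : P.ring.valuation (algebraMap K L t) = P.ring.valuation s ^ e) :
    P.ramificationIdx K = e := by
  rw [ValuationSubring.maximalIdeal_eq_span_iff] at ht
  obtain ⟨h1, h2⟩ := ht
  unfold Place.LiesOver at hPp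
  let _ := (P.restrictHom K).toAlgebra
  have hval : ∀ x : P.ring.comap (algebraMap K L),
      x ∈ (maximalIdeal P.ring).under (P.ring.comap (algebraMap K L)) ↔
        p.ring.valuation x < 1 := by
    intro x
    rw [Ideal.under_def, Ideal.mem_comap, ValuationSubring.valuation_lt_one_iff]
    have h3 := valuation_lt_iff_of_comap_eq hPp x 1
    rwa [map_one, map_one, map_one] at h3
  let t' : P.ring.comap (algebraMap K L) := ⟨t, hPp.ge t.2⟩
  have ht' : (algebraMap (P.ring.comap (algebraMap K L)) P.ring t' : L) = algebraMap K L t := rfl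
  have htmap : algebraMap _ P.ring t' ∈
      ((maximalIdeal P.ring).under (P.ring.comap (algebraMap K L))).map (algebraMap _ P.ring) :=
    Ideal.mem_map_of_mem _ ((hval t').mpr h1)
  have hs' := (P.ring.maximalIdeal_eq_span_iff s).mp hs
  have hs0 : (algebraMap K L t) ≠ 0 := by simpa using ht0
  unfold Place.ramificationIdx
  rw [← Ideal.ramificationIdx'_eq_ramificationIdx'
    ((maximalIdeal P.ring).under (P.ring.comap (algebraMap K L)))]
  · refine Ideal.ramificationIdx'_spec ?_ fun hle => ?_
    · rw [Ideal.map_le_iff_le_comap]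
      intro x hx
      rw [hval] at hx
      rw [Ideal.mem_comap, hs, Ideal.span_singleton_pow, ValuationSubring.mem_span_singleton_iff]
      push_cast
      rw [map_pow, ← he]
      exact (valuation_le_iff_of_comap_eq hPp x t).mpr (h2 x hx)
    · have h4 := hle htmap
      rw [hs, Ideal.span_singleton_pow, ValuationSubring.mem_span_singleton_iff] at h4
      push_cast at h4
      rw [map_pow, ht', he] at h4
      have h5 : 0 < P.ring.valuation s ^ e := by
        rw [← he]
        exact zero_lt_iff.mpr ((Valuation.ne_zero_iff _).mpr hs0)
      exact absurd h4 (not_le.mpr (by rw [pow_succ]; exact mul_lt_of_lt_one_right h5 hs'.1))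
  · intro hbot
    rw [hbot, Ideal.mem_bot] at htmap
    exact hs0 (ht' ▸ congrArg Subtype.val htmap)

/-- If a place has ramification index three, the value group of the extension contains a value
outside that of the base whose triple lies in that of the base. -/
theorem Place.exists_valuation_pow_three_eq {P : Place k L} {p : Place k K} (hPp : P.LiesOver p)
    [IsDiscreteValuationRing P.ring] [IsDiscreteValuationRing p.ring]
    (he : P.ramificationIdx K = 3) :
    ∃ s : L, (∃ t : K, P.ring.valuation s ^ 3 = P.ring.valuation (algebraMap K L t)) ∧
      ∀ c : K, P.ring.valuation s ≠ P.ring.valuation (algebraMap K L c) := by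
  obtain ⟨t, ht, ht0⟩ := p.ring.exists_uniformizer
  obtain ⟨s, hs, hs0⟩ := P.ring.exists_uniformizer
  obtain ⟨h1, h2⟩ := (p.ring.maximalIdeal_eq_span_iff t).mp ht
  have h3 := (valuation_lt_iff_of_comap_eq hPp t 1).mpr (by rwa [map_one])
  rw [map_one, map_one] at h3
  obtain ⟨n, hn⟩ := P.ring.exists_valuation_eq_pow hs (x := algebraMap K L t)
    (by simpa using ht0) h3.le
  have hn3 : n = 3 := by rw [← he, Place.ramificationIdx_eq hPp ht ht0 hs hn]
  subst hn3
  refine ⟨s, ⟨t, hn.symm⟩, fun c hc => ?_⟩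
  rw [hc, ← map_pow, ← map_pow, valuation_eq_iff_of_comap_eq hPp, map_pow] at hn
  have hc1 : p.ring.valuation c < 1 := by
    by_contra! h
    exact absurd h1 (not_lt.mpr (hn ▸ one_le_pow₀ h))
  have hc2 := h2 c hc1
  have hpos : 0 < p.ring.valuation c := by
    rw [zero_lt_iff]
    intro h
    rw [h, zero_pow three_ne_zero, Valuation.zero_iff] at hn
    exact ht0 hn
  rw [hn] at hc2
  have : p.ring.valuation c ^ 3 < p.ring.valuation c := by
    calc p.ring.valuation c ^ 3 = p.ring.valuation c * p.ring.valuation c ^ 2 := pow_succ' _ 2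
      _ < p.ring.valuation c := mul_lt_of_lt_one_right hpos (pow_lt_one₀ zero_le hc1 two_ne_zero)
  exact absurd hc2 (not_le.mpr this)

end Ramification

/-! ### Places in quadratic extensions -/

section Quadratic

variable {k K K' : Type*} [Field k] [Field K] [Field K'] [Algebra k K] [Algebra k K'] [Algebra K K']
  [IsScalarTower k K K']

/-- `σ` is a conjugation of the quadratic extension `K' / K`: a nontrivial involution for which
the trace `x + σ x` and the norm `x * σ x` lie in `K`. -/
structure IsConjugation (σ : K' ≃ₐ[K] K') : Prop where
  ne_one : σ ≠ 1
  apply_apply : ∀ x, σ (σ x) = x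
  trace_mem : ∀ x, ∃ s : K, algebraMap K K' s = x + σ x
  norm_mem : ∀ x, ∃ n : K, algebraMap K K' n = x * σ x

theorem exists_isConjugation [Algebra.IsSeparable K K'] (h : Module.finrank K K' = 2) :
    ∃ σ : K' ≃ₐ[K] K', IsConjugation σ := by
  have : Algebra.IsQuadraticExtension K K' := ⟨h⟩
  have : FiniteDimensional K K' := Module.finite_of_finrank_pos (by omega)
  have hcard := IsGalois.card_aut_eq_finrank K K'
  rw [h] at hcard
  obtain ⟨σ, hσ, huniq⟩ := (Nat.card_eq_two_iff' (1 : K' ≃ₐ[K] K')).mp hcard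
  have hall : ∀ τ : K' ≃ₐ[K] K', τ = 1 ∨ τ = σ := fun τ => by
    by_cases hτ : τ = 1
    · exact Or.inl hτ
    · exact Or.inr (huniq τ hτ)
  have hσσ : ∀ x, σ (σ x) = x := by
    intro x
    rcases hall (σ * σ) with h1 | h1
    · exact congrArg (fun τ : K' ≃ₐ[K] K' => τ x) h1
    · exact absurd (mul_eq_left.mp h1) hσ
  refine ⟨σ, hσ, hσσ, fun x => ?_, fun x => ?_⟩
  · refine (IsGalois.mem_range_algebraMap_iff_fixed _).mpr fun τ => ?_
    rcases hall τ with rfl | rfl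
    · rfl
    · rw [map_add, hσσ, add_comm]
  · refine (IsGalois.mem_range_algebraMap_iff_fixed _).mpr fun τ => ?_
    rcases hall τ with rfl | rfl
    · rfl
    · rw [map_mul, hσσ, mul_comm]

theorem isSeparable_or_isPurelyInseparable_of_finrank_prime
    (h : (Module.finrank K K').Prime) :
    Algebra.IsSeparable K K' ∨ IsPurelyInseparable K K' := by
  have : FiniteDimensional K K' := Module.finite_of_finrank_pos h.pos
  have := IntermediateField.isSimpleOrder_of_finrank_prime K K' h
  rcases eq_bot_or_eq_top (separableClosure K K') with h | h
  · exact Or.inr (separableClosure.eq_bot_iff.mp h)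
  · exact Or.inl ((separableClosure.eq_top_iff K K').mp h)

omit [IsScalarTower k K K'] in
/-- Some power of each element lies in the base field, so the place below determines the valuation
ring. -/
theorem Place.eq_of_liesOver_of_isPurelyInseparable [IsPurelyInseparable K K'] {p : Place k K}
    {P Q : Place k K'} (hP : P.LiesOver p) (hQ : Q.LiesOver p) : P = Q := by
  obtain ⟨q, hq⟩ := ExpChar.exists K
  have key : ∀ {P : Place k K'}, P.LiesOver p → ∀ (x : K') (n : ℕ) (y : K),
      algebraMap K K' y = x ^ q ^ n → (x ∈ P.ring ↔ y ∈ p.ring) := by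
    intro P hP x n y hy
    rw [← hP, ValuationSubring.mem_comap, hy, ← ValuationSubring.valuation_le_one_iff,
      ← ValuationSubring.valuation_le_one_iff, map_pow]
    have hq0 : q ^ n ≠ 0 := pow_ne_zero _ (expChar_pos K q).ne'
    exact (pow_le_one_iff hq0).symm
  ext x
  obtain ⟨n, y, hy⟩ := IsPurelyInseparable.pow_mem K q x
  exact (key hP x n y hy).trans (key hQ x n y hy).symm

/-- The conjugate of a place under an automorphism. -/
def Place.conj (σ : K' ≃ₐ[K] K') (P : Place k K') : Place k K' where
  ring := P.ring.comap (σ : K' →+* K')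
  algebraMap_mem c := by
    rw [ValuationSubring.mem_comap, IsScalarTower.algebraMap_apply k K K']
    change σ (algebraMap K K' (algebraMap k K c)) ∈ P.ring
    rw [σ.commutes, ← IsScalarTower.algebraMap_apply k K K']
    exact P.algebraMap_mem c
  ne_top h := P.ne_top (eq_top_iff.mpr fun x _ => by
    have : σ.symm x ∈ P.ring.comap (σ : K' →+* K') := h ▸ ValuationSubring.mem_top _
    rw [ValuationSubring.mem_comap] at this
    change σ (σ.symm x) ∈ P.ring at this
    rwa [σ.apply_symm_apply] at this)

theorem Place.mem_conj {σ : K' ≃ₐ[K] K'} {P : Place k K'} {x : K'} :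
    x ∈ (P.conj σ).ring ↔ σ x ∈ P.ring := Iff.rfl

theorem Place.LiesOver.conj {P : Place k K'} {p : Place k K} (h : P.LiesOver p)
    (σ : K' ≃ₐ[K] K') : (P.conj σ).LiesOver p := by
  refine Eq.trans ?_ h
  ext x
  rw [ValuationSubring.mem_comap, Place.mem_conj, σ.commutes, ValuationSubring.mem_comap]

theorem Place.valuation_conj_le_iff (σ : K' ≃ₐ[K] K') (P : Place k K') (x y : K') :
    P.ring.valuation (σ x) ≤ P.ring.valuation (σ y) ↔
      (P.conj σ).ring.valuation x ≤ (P.conj σ).ring.valuation y := by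
  let _ := (σ : K' →+* K').toAlgebra
  exact valuation_le_iff_of_comap_eq (F := K') (E := K') (A := (P.conj σ).ring) (B := P.ring)
    rfl x y

theorem Place.valuation_conj_eq_iff (σ : K' ≃ₐ[K] K') (P : Place k K') (x y : K') :
    P.ring.valuation (σ x) = P.ring.valuation (σ y) ↔
      (P.conj σ).ring.valuation x = (P.conj σ).ring.valuation y := by
  rw [le_antisymm_iff, le_antisymm_iff, P.valuation_conj_le_iff, P.valuation_conj_le_iff]

/-- In a separable quadratic extension, the places above a given place are conjugate. If `Q` were
different from `P` and its conjugate, there would be an element integral at the latter two but not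
at `Q`; its trace and norm are integral below, so it is integral at `Q` after all. -/
theorem Place.eq_or_eq_conj {σ : K' ≃ₐ[K] K'} (hσ : IsConjugation σ) {p : Place k K}
    {P Q : Place k K'} [IsDiscreteValuationRing P.ring] [IsDiscreteValuationRing (P.conj σ).ring]
    (hP : P.LiesOver p) (hQ : Q.LiesOver p) : Q = P ∨ Q = P.conj σ := by
  have hmem : ∀ z : K', z ∈ P.ring → σ z ∈ P.ring → z ∈ Q.ring := by
    intro z hz hz'
    by_contra hzQ
    obtain ⟨s, hs⟩ := hσ.trace_mem z
    obtain ⟨n, hn⟩ := hσ.norm_mem z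
    have hbase : ∀ c : K, algebraMap K K' c ∈ P.ring → algebraMap K K' c ∈ Q.ring := by
      intro c hc
      have h1 : c ∈ p.ring := hP.le hc
      exact hQ.ge h1
    have hsQ := hbase s (hs ▸ P.ring.add_mem _ _ hz hz')
    have hnQ := hbase n (hn ▸ P.ring.mul_mem _ _ hz hz')
    have hinv : z⁻¹ ∈ Q.ring := (Q.ring.mem_or_inv_mem z).resolve_left hzQ
    have hz0 : z ≠ 0 := by
      rintro rfl
      exact hzQ Q.ring.zero_mem
    -- `z = s - n / z`
    refine hzQ ?_
    have : z = algebraMap K K' s - algebraMap K K' n * z⁻¹ := by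
      rw [hs, hn]
      field_simp
      ring
    rw [this]
    exact Q.ring.toSubring.sub_mem hsQ (Q.ring.mul_mem _ _ hnQ hinv)
  have hne : ∀ {P : Place k K'} [IsDiscreteValuationRing P.ring], Q ≠ P →
      ∃ x, x ∈ P.ring ∧ x ∉ Q.ring := by
    intro P _ h
    by_contra! hcon
    exact h (Place.ext (ValuationSubring.eq_of_le_of_ne_top _ hcon Q.ne_top)).symm
  by_contra! hcon
  obtain ⟨x, hx, hxQ⟩ := hne hcon.1
  obtain ⟨y, hy, hyQ⟩ := hne hcon.2
  rw [Place.mem_conj] at hy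
  by_cases hx' : σ x ∈ P.ring
  · exact hxQ (hmem x hx hx')
  by_cases hy' : y ∈ P.ring
  · exact hyQ (hmem y hy' hy)
  have hxinv : x⁻¹ ∈ Q.ring.nonunits := by
    rw [ValuationSubring.inv_mem_nonunits_iff]
    exact Or.inr hxQ
  have hyinv : y⁻¹ ∈ Q.ring.nonunits := by
    rw [ValuationSubring.inv_mem_nonunits_iff]
    exact Or.inr hyQ
  have hmemz : ∀ {x y : K'}, x ≠ 0 → x ∈ P.ring → y ∉ P.ring → (x⁻¹ + y⁻¹)⁻¹ ∈ P.ring := by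
    intro x y hx0 hx hy
    have hy1 : P.ring.valuation y⁻¹ < 1 := by
      rw [← ValuationSubring.mem_nonunits_iff, ValuationSubring.inv_mem_nonunits_iff]
      exact Or.inr hy
    rw [← ValuationSubring.valuation_le_one_iff] at hx ⊢
    have hx1 : 1 ≤ P.ring.valuation x⁻¹ := by
      rwa [Valuation.one_le_val_iff _ (inv_ne_zero hx0), inv_inv]
    rw [map_inv₀, Valuation.map_add_eq_of_lt_left _ (hy1.trans_le hx1)]
    exact inv_le_one_of_one_le₀ hx1
  have hx0 : x ≠ 0 := by
    rintro rfl
    exact hxQ Q.ring.zero_mem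
  have hy0 : σ y ≠ 0 := by
    rw [_root_.map_ne_zero]
    rintro rfl
    exact hyQ Q.ring.zero_mem
  have hz := hmemz hx0 hx hy'
  have hz' : σ (x⁻¹ + y⁻¹)⁻¹ ∈ P.ring := by
    rw [map_inv₀, map_add, map_inv₀, map_inv₀, add_comm]
    exact hmemz hy0 hy hx'
  have h0 := hmem _ hz hz'
  have h1 := Q.ring.inv_mem_nonunits_iff (x := (x⁻¹ + y⁻¹)⁻¹)
  rw [inv_inv] at h1
  rcases h1.mp (Q.ring.nonunits.add_mem hxinv hyinv) with h2 | h2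
  · rw [inv_eq_zero, add_eq_zero_iff_eq_neg, ← inv_neg, inv_inj] at h2
    exact hy' (by simpa [h2] using P.ring.neg_mem _ hx)
  · exact h2 h0

theorem Place.splitsIn_iff {σ : K' ≃ₐ[K] K'} (hσ : IsConjugation σ)
    (hquad : Module.finrank K K' = 2) {p : Place k K} {P : Place k K'}
    [IsDiscreteValuationRing P.ring] [IsDiscreteValuationRing (P.conj σ).ring] (hP : P.LiesOver p) :
    p.SplitsIn K' ↔ P.conj σ ≠ P := by
  have hset : {Q : Place k K' | Q.LiesOver p} = {P, P.conj σ} := by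
    ext Q
    refine ⟨fun hQ => Place.eq_or_eq_conj hσ hP hQ, ?_⟩
    rintro (rfl | rfl)
    · exact hP
    · exact hP.conj σ
  rw [Place.SplitsIn, hset, hquad]
  constructor
  · intro h heq
    rw [heq, Set.pair_eq_singleton, Set.ncard_singleton] at h
    omega
  · intro h
    exact Set.ncard_pair h.symm

end Quadratic

/-! ### Principal divisors in genus zero -/

section GenusZero

variable {κ F : Type*} [Field κ] [Field F] [Algebra κ F]

theorem Divisor.degree_add (D E : Divisor κ F) : (D + E).degree = D.degree + E.degree :=
  Finsupp.sum_add_index' (fun _ => zero_mul _) fun _ _ _ => add_mul _ _ _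

theorem Divisor.degree_single (P : Place κ F) (n : ℤ) :
    Divisor.degree (Finsupp.single P n) = n * P.degree :=
  Finsupp.sum_single_index (zero_mul _)

theorem Divisor.degree_nsmul (n : ℕ) (D : Divisor κ F) : (n • D).degree = n * D.degree := by
  induction n with
  | zero => simp [Divisor.degree]
  | succ n ih =>
    rw [add_smul, one_smul, Divisor.degree_add, ih]
    push_cast
    ring

theorem HasGenus.degree_add_one_le {D : Divisor κ F} (hg : HasGenus κ F 0) :
    D.degree + 1 ≤ Module.finrank κ (riemannRochSpace D) := by
  have : D.degree - (Module.finrank κ (riemannRochSpace D) : ℤ) + 1 ≤ 0 := hg.2 ⟨D, rfl⟩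
  omega

/-- In genus zero, a function `f` in the Riemann–Roch space of a divisor `D` of degree zero has
divisor exactly `-D`. If it had an additional zero at a place `P`, then multiplication by `f ^ n`
would embed the Riemann–Roch space of `n • (P - D)`, of dimension more than `n`, into that of the
divisor zero, for every `n`. -/
theorem HasGenus.valuation_eq_one_of_mem (hg : HasGenus κ F 0) {D : Divisor κ F}
    (hD : D.degree = 0) {f : F} (hf0 : f ≠ 0) (hf : f ∈ riemannRochSpace D) (P : Place κ F)
    (hdeg : 0 < P.degree) {ϖ : P.ring} (hϖ : maximalIdeal P.ring = Ideal.span {ϖ}) :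
    P.ring.valuation (f * (ϖ : F) ^ D P) = 1 := by
  classical
  have hle : P.ring.valuation (f * (ϖ : F) ^ D P) ≤ 1 := by
    rw [ValuationSubring.valuation_le_one_iff]
    exact hf P ϖ hϖ
  refine le_antisymm hle (not_lt.mp fun hlt => ?_)
  have hϖlt := ((P.ring.maximalIdeal_eq_span_iff ϖ).mp hϖ).1
  -- Then `f` even lies in the Riemann–Roch space of `D - P`.
  set E : Divisor κ F := Finsupp.single P 1 - D with hE
  have hfE : ∀ (R : Place κ F) (r : R.ring), maximalIdeal R.ring = Ideal.span {r} →
      (r : F) ≠ 0 → f * (r : F) ^ (-E R) ∈ R.ring := by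
    intro R r hr hr0
    rcases eq_or_ne R P with rfl | hRP
    · obtain ⟨h1, h2⟩ := (R.ring.maximalIdeal_eq_span_iff r).mp hr
      obtain ⟨h3, h4⟩ := (R.ring.maximalIdeal_eq_span_iff ϖ).mp hϖ
      have heq : R.ring.valuation (r : F) = R.ring.valuation (ϖ : F) :=
        le_antisymm (h4 _ h1) (h2 _ h3)
      have h5 : R.ring.valuation (f * (r : F) ^ D R) ≤ R.ring.valuation (r : F) := by
        refine h2 _ ?_
        rw [map_mul, map_zpow₀, heq]
        rwa [map_mul, map_zpow₀] at hlt
      have h6 : -E R = D R - 1 := by simp [hE]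
      have hv0 : 0 < R.ring.valuation (r : F) := zero_lt_iff.mpr ((Valuation.ne_zero_iff _).mpr hr0)
      rw [h6, zpow_sub_one₀ hr0, ← mul_assoc, ← ValuationSubring.valuation_le_one_iff, map_mul,
        map_inv₀, ← div_eq_mul_inv]
      exact (div_le_one₀ hv0).mpr h5
    · have h6 : -E R = D R := by simp [hE, Finsupp.single_eq_of_ne hRP]
      rw [h6]
      exact hf R r hr
  set n := Module.finrank κ (riemannRochSpace (0 : Divisor κ F)) with hn
  have hmap : ∀ g ∈ riemannRochSpace (n • E), f ^ n * g ∈ riemannRochSpace (0 : Divisor κ F) := by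
    intro g hg R r hr
    rw [Finsupp.zero_apply, zpow_zero, mul_one]
    rcases eq_or_ne (r : F) 0 with hr0 | hr0
    · exfalso
      have h1 := ((R.ring.maximalIdeal_eq_span_iff r).mp hr).2
      obtain ⟨t, ht0, ht⟩ := R.exists_ne_zero_valuation_lt_one
      have h2 := h1 t ht
      rw [hr0, map_zero, le_zero_iff, Valuation.zero_iff] at h2
      exact ht0 h2
    have h1 := R.ring.mul_mem _ _ (pow_mem (hfE R r hr hr0) n) (hg R r hr)
    have h2 : (f * (r : F) ^ (-E R)) ^ n * (g * (r : F) ^ (n • E) R) = f ^ n * g := by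
      rw [Finsupp.smul_apply, mul_pow, ← zpow_natCast ((r : F) ^ (-E R)), ← zpow_mul,
        mul_mul_mul_comm, ← zpow_add₀ hr0]
      simp [mul_comm]
    rwa [h2] at h1
  let φ : riemannRochSpace (n • E) →ₗ[κ] riemannRochSpace (0 : Divisor κ F) :=
    (LinearMap.mulLeft κ (f ^ n)).restrict hmap
  have hφ : Function.Injective φ := by
    intro g h hgh
    have h1 : f ^ n * (g : F) = f ^ n * h := congrArg Subtype.val hgh
    exact Subtype.ext (mul_left_cancel₀ (pow_ne_zero _ hf0) h1)
  have h0 := hg.degree_add_one_le (D := 0)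
  have hE1 := hg.degree_add_one_le (D := n • E)
  have hEdeg : E.degree = P.degree := by
    have h1 : E + D = Finsupp.single P 1 := by rw [hE, sub_add_cancel]
    have h2 := Divisor.degree_add E D
    rw [h1, Divisor.degree_single, hD] at h2
    omega
  have hzero : (0 : Divisor κ F).degree = 0 := Finsupp.sum_zero_index
  rw [Divisor.degree_nsmul, hEdeg] at hE1
  rw [hzero] at h0
  have : Module.Finite κ (riemannRochSpace (0 : Divisor κ F)) :=
    Module.finite_of_finrank_pos (by omega)
  have h1 := LinearMap.finrank_le_finrank_of_injective hφ
  rw [← hn] at h1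
  have h2 : (n : ℤ) * 1 ≤ n * P.degree := by
    gcongr
    exact_mod_cast hdeg
  omega

theorem HasGenus.exists_mem (hg : HasGenus κ F 0) {D : Divisor κ F} (hD : D.degree = 0) :
    ∃ f ∈ riemannRochSpace D, f ≠ 0 := by
  have h := hg.degree_add_one_le (D := D)
  rw [hD] at h
  have : Nontrivial (riemannRochSpace D) := Module.nontrivial_of_finrank_pos (R := κ) (by omega)
  obtain ⟨f, hf⟩ := exists_ne (0 : riemannRochSpace D)
  exact ⟨f, f.2, fun h => hf (Subtype.ext h)⟩

/-- In genus zero, the difference of two places of equal degree is principal. -/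
theorem HasGenus.exists_valuation_eq (hg : HasGenus κ F 0) {P Q : Place κ F} (hne : P ≠ Q)
    (hdeg : P.degree = Q.degree) (hpos : ∀ R : Place κ F, 0 < R.degree)
    [∀ R : Place κ F, IsDiscreteValuationRing R.ring]
    {s : P.ring} (hs : maximalIdeal P.ring = Ideal.span {s})
    {t : Q.ring} (ht : maximalIdeal Q.ring = Ideal.span {t}) :
    ∃ f : F, f ≠ 0 ∧ P.ring.valuation f = P.ring.valuation s ∧
      Q.ring.valuation f = (Q.ring.valuation t)⁻¹ ∧
      ∀ R : Place κ F, R ≠ P → R ≠ Q → R.ring.valuation f = 1 := by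
  classical
  set D : Divisor κ F := Finsupp.single Q 1 - Finsupp.single P 1 with hDdef
  have hD : D.degree = 0 := by
    have h1 : D + Finsupp.single P 1 = Finsupp.single Q 1 := by rw [hDdef, sub_add_cancel]
    have h2 := Divisor.degree_add D (Finsupp.single P 1)
    rw [h1, Divisor.degree_single, Divisor.degree_single, hdeg] at h2
    omega
  obtain ⟨f, hf, hf0⟩ := hg.exists_mem hD
  have key := fun (R : Place κ F) {r : R.ring} (hr : maximalIdeal R.ring = Ideal.span {r}) =>
    hg.valuation_eq_one_of_mem hD hf0 hf R (hpos R) hr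
  refine ⟨f, hf0, ?_, ?_, fun R hRP hRQ => ?_⟩
  · have h1 := key P hs
    have h2 : D P = -1 := by simp [hDdef, Finsupp.single_eq_of_ne hne]
    rw [h2, zpow_neg_one, map_mul, map_inv₀] at h1
    rw [eq_inv_of_mul_eq_one_left h1, inv_inv]
  · have h1 := key Q ht
    have h2 : D Q = 1 := by simp [hDdef, Finsupp.single_eq_of_ne hne.symm]
    rw [h2, zpow_one, map_mul] at h1
    exact eq_inv_of_mul_eq_one_left h1
  · obtain ⟨r, hr, -⟩ := R.ring.exists_uniformizer
    have h1 := key R hr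
    have h2 : D R = 0 := by
      simp [hDdef, Finsupp.single_eq_of_ne hRP, Finsupp.single_eq_of_ne hRQ]
    rwa [h2, zpow_zero, mul_one] at h1

end GenusZero

open IntermediateField

/-! ### Cardano's formula -/

section Cardano

variable {F Ω : Type*} [Field F] [Field Ω] [Algebra F Ω]

theorem isPurelyCubic_iff_exists_adjoin_eq (N : IntermediateField F Ω) :
    IsPurelyCubic F N ↔ ∃ (y : Ω) (β : F), F⟮y⟯ = N ∧ minpoly F y = X ^ 3 - C β := by
  constructor
  · rintro ⟨y, β, h1, h2⟩
    refine ⟨y, β, ?_, ?_⟩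
    · rw [← lift_adjoin_simple, h1, lift_top]
    · rw [← h2]
      exact minpoly.algebraMap_eq (algebraMap N Ω).injective y
  · rintro ⟨y, β, rfl, h2⟩
    refine ⟨AdjoinSimple.gen F y, β, ?_, ?_⟩
    · apply lift_injective
      rw [lift_adjoin_simple, lift_top, AdjoinSimple.coe_gen]
    · rw [minpoly_gen, h2]

theorem eq_zero_of_quadratic_eq_zero {θ : Ω} (hθ : (minpoly F θ).natDegree = 3) {p q r : F}
    (h : algebraMap F Ω p * θ ^ 2 + algebraMap F Ω q * θ + algebraMap F Ω r = 0) :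
    p = 0 ∧ q = 0 ∧ r = 0 := by
  have h0 : C p * X ^ 2 + C q * X + C r = 0 := by
    by_contra hne
    have h1 := minpoly.degree_le_of_ne_zero F θ hne (by simpa using h)
    rw [degree_eq_natDegree fun h => by simp [h] at hθ, hθ] at h1
    have h2 := h1.trans degree_quadratic_le
    exact absurd h2 (by decide)
  refine ⟨?_, ?_, ?_⟩
  · simpa using congrArg (fun P => coeff P 2) h0
  · simpa using congrArg (fun P => coeff P 1) h0
  · simpa using congrArg (fun P => coeff P 0) h0

/-- A generator of trace zero of a purely cubic extension is a sum of two cubic radicals whose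
product is the one occurring in Cardano's formula. -/
theorem exists_cardano_of_minpoly_eq (h3 : (3 : F) ≠ 0) {θ y : Ω} {a b β : F}
    (hθ : θ ^ 3 = 3 * algebraMap F Ω a * θ + algebraMap F Ω b)
    (hadj : F⟮y⟯ = F⟮θ⟯) (hy : minpoly F y = X ^ 3 - C β) :
    ∃ u v : Ω, u + v = θ ∧ u * v = algebraMap F Ω a ∧
      (∃ c : F, algebraMap F Ω c = u ^ 3) ∧ ∃ c : F, algebraMap F Ω c = v ^ 3 := by
  have hdeg : (minpoly F y).natDegree = 3 := by rw [hy, natDegree_X_pow_sub_C]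
  have hyint : IsIntegral F y := by
    by_contra h
    rw [minpoly.eq_zero h, natDegree_zero] at hdeg
    omega
  have hθint : IsIntegral F θ := by
    refine ⟨X ^ 3 - (C (3 * a) * X + C b), ?_, ?_⟩
    · exact monic_X_pow_sub (degree_linear_le.trans_lt (by norm_num))
    · rw [← aeval_def]
      simp only [map_sub, map_add, map_mul, map_pow, aeval_X, aeval_C, map_ofNat, hθ, sub_self]
  have hθdeg : (minpoly F θ).natDegree = 3 := by
    rw [← adjoin.finrank hθint, ← hadj, adjoin.finrank hyint, hdeg]
  have hy3 : y ^ 3 = algebraMap F Ω β := by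
    have := minpoly.aeval F y
    rwa [hy, map_sub, map_pow, aeval_X, aeval_C, sub_eq_zero] at this
  obtain ⟨c₀, c₁, c₂, hc⟩ : ∃ c₀ c₁ c₂ : F,
      θ = algebraMap F Ω c₀ + algebraMap F Ω c₁ * y + algebraMap F Ω c₂ * y ^ 2 := by
    have hmem : θ ∈ F⟮y⟯.toSubalgebra := hadj ▸ mem_adjoin_simple_self F θ
    rw [adjoin_simple_toSubalgebra_of_isAlgebraic hyint.isAlgebraic,
      Algebra.adjoin_singleton_eq_range_aeval] at hmem
    obtain ⟨r, hr⟩ := hmem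
    have hmonic := minpoly.monic hyint
    have hlt := degree_modByMonic_lt r hmonic
    rw [degree_eq_natDegree (minpoly.ne_zero hyint), hdeg] at hlt
    have hle : (r %ₘ minpoly F y).degree ≤ 2 := Order.le_of_lt_succ hlt
    refine ⟨(r %ₘ minpoly F y).coeff 0, (r %ₘ minpoly F y).coeff 1, (r %ₘ minpoly F y).coeff 2, ?_⟩
    have h1 : aeval y (r %ₘ minpoly F y) = θ :=
      (aeval_modByMonic_eq_self_of_root (minpoly.aeval F y)).trans hr
    conv_lhs => rw [← h1, eq_quadratic_of_degree_le_two hle]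
    simp only [map_add, map_mul, aeval_C, map_pow, aeval_X]
    ring
  have hrel : algebraMap F Ω (3 * c₀) * θ ^ 2
      + algebraMap F Ω (3 * (c₁ * c₂ * β) - 3 * c₀ ^ 2 - 3 * a) * θ
      + algebraMap F Ω (c₀ ^ 3 - 3 * (c₁ * c₂ * β) * c₀ + c₁ ^ 3 * β + c₂ ^ 3 * β ^ 2 - b) = 0 := by
    simp only [map_mul, map_sub, map_add, map_pow, map_ofNat, ← hy3]
    have h1 : (θ - algebraMap F Ω c₀) = algebraMap F Ω c₁ * y + algebraMap F Ω c₂ * y ^ 2 := by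
      rw [hc]; ring
    have h2 : (θ - algebraMap F Ω c₀) ^ 3 = 3 * (algebraMap F Ω c₁ * algebraMap F Ω c₂ * y ^ 3) *
        (θ - algebraMap F Ω c₀) + algebraMap F Ω c₁ ^ 3 * y ^ 3
          + algebraMap F Ω c₂ ^ 3 * (y ^ 3) ^ 2 := by
      rw [h1]; ring
    linear_combination hθ - h2
  obtain ⟨h0, h1, -⟩ := eq_zero_of_quadratic_eq_zero hθdeg hrel
  have hc0 : c₀ = 0 := (mul_eq_zero.mp h0).resolve_left h3
  have ha : c₁ * c₂ * β = a := by
    refine mul_left_cancel₀ h3 ?_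
    rw [hc0] at h1
    linear_combination h1
  refine ⟨algebraMap F Ω c₁ * y, algebraMap F Ω c₂ * y ^ 2, ?_, ?_, ⟨c₁ ^ 3 * β, ?_⟩,
    ⟨c₂ ^ 3 * β ^ 2, ?_⟩⟩
  · rw [hc, hc0, map_zero, zero_add]
  · rw [← ha, map_mul, map_mul, ← hy3]; ring
  · rw [map_mul, map_pow, ← hy3]; ring
  · rw [map_mul, map_pow, map_pow, ← hy3]; ring

/-- Cardano's formula: an element of degree three that is the sum of two cubic radicals whose
product lies in the base generates a purely cubic extension. -/
theorem minpoly_eq_of_cardano {θ u v : Ω} (hθ : (minpoly F θ).natDegree = 3) {a β : F}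
    (hadd : u + v = θ) (hmul : u * v = algebraMap F Ω a) (hu0 : u ≠ 0)
    (hu : u ^ 3 = algebraMap F Ω β) : F⟮u⟯ = F⟮θ⟯ ∧ minpoly F u = X ^ 3 - C β := by
  have hroot : aeval u (X ^ 3 - C β) = 0 := by
    rw [map_sub, map_pow, aeval_X, aeval_C, hu, sub_self]
  have hmonic : (X ^ 3 - C β).Monic := monic_X_pow_sub_C β three_ne_zero
  have huint : IsIntegral F u := ⟨_, hmonic, hroot⟩
  have hθint : IsIntegral F θ := by
    by_contra h
    rw [minpoly.eq_zero h, natDegree_zero] at hθ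
    omega
  have hdvd := minpoly.dvd F u hroot
  have hle : (minpoly F u).natDegree ≤ 3 :=
    (natDegree_le_of_dvd hdvd hmonic.ne_zero).trans natDegree_X_pow_sub_C.le
  have hv : v = algebraMap F Ω a / u := by rw [← hmul]; field_simp
  have hmem : θ ∈ F⟮u⟯ := by
    rw [← hadd, hv]
    exact add_mem (mem_adjoin_simple_self F u)
      (div_mem (_root_.algebraMap_mem _ a) (mem_adjoin_simple_self F u))
  have := adjoin.finiteDimensional huint
  have heq : F⟮θ⟯ = F⟮u⟯ := eq_of_le_of_finrank_le (adjoin_simple_le_iff.mpr hmem) (by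
    rw [adjoin.finrank hθint, adjoin.finrank huint, hθ]; exact hle)
  refine ⟨heq.symm, (eq_of_monic_of_dvd_of_natDegree_le (minpoly.monic huint) hmonic hdvd ?_).symm⟩
  rw [natDegree_X_pow_sub_C, ← adjoin.finrank huint, ← heq, adjoin.finrank hθint, hθ]

/-- An extension of degree three in characteristic different from three has a generator of trace
zero. -/
theorem exists_depressed_generator {L : Type*} [Field L] [Algebra F L]
    (hL : Module.finrank F L = 3) (h3 : (3 : F) ≠ 0) :
    ∃ (θ : L) (a b : F), F⟮θ⟯ = ⊤ ∧
      θ ^ 3 = 3 * algebraMap F L a * θ + algebraMap F L b := by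
  have : FiniteDimensional F L := Module.finite_of_finrank_pos (by omega)
  have := isSimpleOrder_of_finrank_prime F L (hL ▸ Nat.prime_three)
  obtain ⟨x, hx⟩ : ∃ x : L, x ∉ (⊥ : IntermediateField F L) := by
    by_contra! h
    exact bot_ne_top (α := IntermediateField F L)
      (SetLike.ext fun x => ⟨fun _ => trivial, fun _ => h x⟩)
  have htop : ∀ z : L, z ∉ (⊥ : IntermediateField F L) → F⟮z⟯ = ⊤ := fun z hz =>
    (eq_bot_or_eq_top F⟮z⟯).resolve_left fun h => hz (h ▸ mem_adjoin_simple_self F z)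
  have hint : IsIntegral F x := Algebra.IsIntegral.isIntegral x
  have hdeg : (minpoly F x).natDegree = 3 := by
    rw [← adjoin.finrank hint, htop x hx, finrank_top', hL]
  have hroot := minpoly.aeval F x
  have hlead : (minpoly F x).coeff 3 = 1 := by
    have := minpoly.monic hint
    rwa [Monic, leadingCoeff, hdeg] at this
  rw [aeval_eq_sum_range, hdeg] at hroot
  simp only [Finset.sum_range_succ, Finset.sum_range_zero, hlead, Algebra.smul_def] at hroot
  set c₀ := (minpoly F x).coeff 0
  set c₁ := (minpoly F x).coeff 1
  set c₂ := (minpoly F x).coeff 2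
  -- The Tschirnhaus substitution, scaled to avoid denominators.
  refine ⟨3 * x + algebraMap F L c₂, c₂ ^ 2 - 3 * c₁, -2 * c₂ ^ 3 + 9 * c₁ * c₂ - 27 * c₀,
    htop _ fun h => hx ?_, ?_⟩
  · have h1 : x = algebraMap F L 3⁻¹ * ((3 * x + algebraMap F L c₂) - algebraMap F L c₂) := by
      have h3' : (3 : L) ≠ 0 := by
        rw [← map_ofNat (algebraMap F L) 3]
        simpa using h3
      rw [map_inv₀, map_ofNat]
      field_simp
      ring
    rw [h1]
    exact mul_mem (_root_.algebraMap_mem _ _) (sub_mem h (_root_.algebraMap_mem _ _))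
  · simp only [map_mul, map_sub, map_add, map_neg, map_pow, map_ofNat, map_one] at hroot ⊢
    linear_combination 27 * hroot

end Cardano

/-! ### The purely cubic closure -/

section Closure

variable {K Ω : Type*} [Field K] [Field Ω] [Algebra K Ω]

theorem extendScalars_sup_eq_adjoin {L : IntermediateField K Ω} {θ : Ω} (hL : K⟮θ⟯ = L)
    (M : IntermediateField K Ω) : extendScalars (le_sup_right : M ≤ L ⊔ M) = M⟮θ⟯ := by
  refine restrictScalars_injective K ?_
  rw [extendScalars_restrictScalars, restrictScalars_adjoin_eq_sup, hL, sup_comm]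

/-- Over the purely cubic closure, a cubic extension is obtained by Cardano's formula, and the
radicands generate the closure if that is quadratic. -/
theorem IsPurelyCubicClosure.exists_cardano {L K' : IntermediateField K Ω} (h3 : (3 : K) ≠ 0)
    (hL : Module.finrank K L = 3) (hquad : Module.finrank K K' = 2)
    (hcl : IsPurelyCubicClosure L K') :
    ∃ (u v : Ω) (a b : K) (β β' : K'), K⟮u + v⟯ = L ∧ u * v = algebraMap K Ω a ∧
      (β : Ω) = u ^ 3 ∧ (β' : Ω) = v ^ 3 ∧ β + β' = algebraMap K K' b ∧
      β * β' = algebraMap K K' a ^ 3 ∧ β ≠ β' ∧ β ∉ (⊥ : IntermediateField K K') := by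
  obtain ⟨θ, a, b, hθ, hroot⟩ := exists_depressed_generator hL h3
  have hadj : K⟮(θ : Ω)⟯ = L := by rw [← lift_adjoin_simple, hθ, lift_top]
  have hrootΩ : (θ : Ω) ^ 3 = 3 * algebraMap K Ω a * θ + algebraMap K Ω b :=
    congrArg (algebraMap L Ω) hroot
  have : FiniteDimensional K L := Module.finite_of_finrank_pos (by omega)
  have hint : IsIntegral K (θ : Ω) := (Algebra.IsIntegral.isIntegral (R := K) θ).map L.val
  have hdeg : (minpoly K (θ : Ω)).natDegree = 3 := by
    rw [← adjoin.finrank hint, hadj, hL]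
  have hθ0 : (θ : Ω) ≠ 0 := by
    intro h
    rw [h, minpoly.zero, natDegree_X] at hdeg
    omega
  obtain ⟨y, γ, hy1, hy2⟩ := (isPurelyCubic_iff_exists_adjoin_eq _).mp hcl.1
  rw [extendScalars_sup_eq_adjoin hadj] at hy1
  have h3' : (3 : K') ≠ 0 := by
    rw [← map_ofNat (algebraMap K K') 3]
    simpa using h3
  obtain ⟨u, v, huv, hmul, ⟨β, hβ⟩, β', hβ'⟩ := exists_cardano_of_minpoly_eq (F := K')
    (a := algebraMap K K' a) (b := algebraMap K K' b) h3' hrootΩ hy1 hy2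
  have hβu : (β : Ω) = u ^ 3 := hβ
  have hβv : (β' : Ω) = v ^ 3 := hβ'
  have hmulK : u * v = algebraMap K Ω a := hmul
  have hadd : β + β' = algebraMap K K' b := by
    apply Subtype.ext
    change (β : Ω) + β' = algebraMap K Ω b
    rw [hβu, hβv]
    rw [← huv, ← hmulK] at hrootΩ
    linear_combination hrootΩ
  have hprod : β * β' = algebraMap K K' a ^ 3 := by
    apply Subtype.ext
    change (β : Ω) * β' = algebraMap K Ω a ^ 3
    rw [hβu, hβv, ← hmulK, mul_pow]
  have hnot : β ∉ (⊥ : IntermediateField K K') := by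
    intro hbot
    -- Otherwise the extension is already purely cubic over the base.
    have key : ∀ {u v : Ω} {c : K}, u + v = θ → u * v = algebraMap K Ω a → u ≠ 0 →
        u ^ 3 = algebraMap K Ω c → False := by
      intro u v c h1 h2 h4 h5
      have hdeg' : (minpoly (⊥ : IntermediateField K Ω) (θ : Ω)).natDegree = 3 := by
        have h8 : (⊥ : IntermediateField K Ω)⟮(θ : Ω)⟯ = extendScalars (bot_le : ⊥ ≤ L) := by
          refine restrictScalars_injective K ?_
          rw [restrictScalars_adjoin_eq_sup, hadj, bot_sup_eq, extendScalars_restrictScalars]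
        rw [← adjoin.finrank hint.tower_top, h8, ← relfinrank_eq_finrank_of_le, relfinrank_bot_left,
          hL]
      obtain ⟨h6, h7⟩ := minpoly_eq_of_cardano (F := (⊥ : IntermediateField K Ω)) hdeg'
        (a := algebraMap K _ a) (β := algebraMap K _ c) h1 h2 h4 h5
      have h8 : K' ≤ ⊥ := hcl.2 ((isPurelyCubic_iff_exists_adjoin_eq _).mpr
        ⟨u, _, by rw [extendScalars_sup_eq_adjoin hadj, h6], h7⟩)
      rw [le_bot_iff.mp h8, IntermediateField.finrank_bot] at hquad
      omega
    obtain ⟨c, hc⟩ := mem_bot.mp hbot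
    by_cases hu : u = 0
    · have hv : v ≠ 0 := by
        rintro rfl
        exact hθ0 (by rw [← huv, hu, add_zero])
      refine key (c := b - c) (by rw [add_comm, huv]) (by rw [mul_comm, hmulK]) hv ?_
      have h1 : β' = algebraMap K K' (b - c) := by
        rw [map_sub, ← hadd, hc, add_sub_cancel_left]
      rw [← hβv, h1]
      rfl
    · refine key (c := c) huv hmulK hu ?_
      rw [← hβu, ← hc]
      rfl
  refine ⟨u, v, a, b, β, β', by rw [huv, hadj], hmulK, hβu, hβv, hadd, hprod, ?_, hnot⟩
  rintro rfl
  by_cases h2 : (2 : K) = 0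
  · -- In characteristic two, `θ` would be a root of a quadratic polynomial.
    have hb : b = 0 := by
      apply (algebraMap K K').injective
      rw [← hadd, ← two_mul, map_zero, ← map_ofNat (algebraMap K K') 2, h2, map_zero, zero_mul]
    rw [hb, map_zero, add_zero] at hrootΩ
    have h4 : algebraMap K Ω 1 * (θ : Ω) ^ 2 + algebraMap K Ω 0 * θ
        + algebraMap K Ω (-3 * a) = 0 := by
      have : (θ : Ω) * ((θ : Ω) ^ 2 - 3 * algebraMap K Ω a) = 0 := by linear_combination hrootΩ
      have := (mul_eq_zero.mp this).resolve_left hθ0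
      rw [map_one, map_zero, map_mul, map_neg, map_ofNat]
      linear_combination this
    exact one_ne_zero (eq_zero_of_quadratic_eq_zero hdeg h4).1
  · refine hnot (mem_bot.mpr ⟨b / 2, ?_⟩)
    have h2' : (2 : K') ≠ 0 := by
      rw [← map_ofNat (algebraMap K K') 2]
      simpa using h2
    rw [map_div₀, ← hadd, map_ofNat]
    field_simp
    ring

/-- Cardano's formula for given radicands `u ^ 3` and `v ^ 3` conjugate over `K`. -/
theorem isPurelyCubicClosure_adjoin {K' : IntermediateField K Ω} (h3 : (3 : K) ≠ 0)
    {u v : Ω} {a b : K} {β β' : K'} (hmul : u * v = algebraMap K Ω a) (hu : (β : Ω) = u ^ 3)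
    (hv : (β' : Ω) = v ^ 3) (hadd : β + β' = algebraMap K K' b) (hu0 : u ≠ 0)
    (htop : K⟮β⟯ = ⊤) (hdeg : (minpoly K' (u + v)).natDegree = 3) :
    IsPurelyCubicClosure K⟮u + v⟯ K' := by
  constructor
  · obtain ⟨h1, h2⟩ := minpoly_eq_of_cardano (F := K') hdeg rfl
      (a := algebraMap K K' a) hmul hu0 hu.symm
    exact (isPurelyCubic_iff_exists_adjoin_eq _).mpr
      ⟨u, β, by rw [extendScalars_sup_eq_adjoin rfl, h1], h2⟩
  · intro M hM
    obtain ⟨y, γ, hy1, hy2⟩ := (isPurelyCubic_iff_exists_adjoin_eq _).mp hM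
    rw [extendScalars_sup_eq_adjoin rfl] at hy1
    have h3' : (3 : M) ≠ 0 := by
      rw [← map_ofNat (algebraMap K M) 3]
      simpa using h3
    have haddΩ : u ^ 3 + v ^ 3 = algebraMap K Ω b := by
      rw [← hu, ← hv]
      exact congrArg Subtype.val hadd
    obtain ⟨u', v', huv', hmul', ⟨c, hc⟩, c', hc'⟩ := exists_cardano_of_minpoly_eq (F := M)
      (θ := u + v) (a := algebraMap K M a) (b := algebraMap K M b) h3'
      (by
        change _ = 3 * algebraMap K Ω a * _ + algebraMap K Ω b
        rw [← hmul, ← haddΩ]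
        ring) hy1 hy2
    have hmul'' : u' * v' = u * v := hmul'.trans hmul.symm
    have hβM : (β : Ω) ∈ M := by
      rw [hu]
      -- The radicands are the roots of the same quadratic polynomial.
      have h1 : (u ^ 3 - u' ^ 3) * (u ^ 3 - v' ^ 3) = 0 := by
        have h4 : u' ^ 3 + v' ^ 3 = u ^ 3 + v ^ 3 := by
          have h5 : (u' + v') ^ 3 = (u + v) ^ 3 := by rw [huv']
          linear_combination h5 - 3 * (u' + v') * hmul'' - 3 * (u * v) * huv'
        have h6 : u' ^ 3 * v' ^ 3 = u ^ 3 * v ^ 3 := by rw [← mul_pow, ← mul_pow, hmul'']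
        linear_combination h6 - u ^ 3 * h4
      rcases mul_eq_zero.mp h1 with h | h
      · rw [sub_eq_zero.mp h, ← hc]
        exact c.2
      · rw [sub_eq_zero.mp h, ← hc']
        exact c'.2
    have h1 : K⟮(β : Ω)⟯ = K' := by rw [← lift_adjoin_simple, htop, lift_top]
    rw [← h1]
    exact adjoin_simple_le_iff.mpr hβM

/-- The element given by Cardano's formula has degree three if the radicand is not a cube. -/
theorem natDegree_minpoly_add_eq_three {F : Type*} [Field F] [Algebra F Ω] {u v : Ω} {a β : F}
    (hmul : u * v = algebraMap F Ω a) (hu : algebraMap F Ω β = u ^ 3) (hcube : ∀ c : F, c ^ 3 ≠ β) :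
    (minpoly F (u + v)).natDegree = 3 := by
  have hirr : Irreducible (X ^ 3 - C β) := X_pow_sub_C_irreducible_of_prime Nat.prime_three hcube
  have hmin : minpoly F u = X ^ 3 - C β :=
    (minpoly.eq_of_irreducible_of_monic hirr (by simp [hu])
      (monic_X_pow_sub_C β three_ne_zero)).symm
  have hdeg : (minpoly F u).natDegree = 3 := by rw [hmin, natDegree_X_pow_sub_C]
  have hu0 : u ≠ 0 := by
    rintro rfl
    rw [minpoly.zero, natDegree_X] at hdeg
    omega
  have hint : IsIntegral F u :=
    ⟨_, monic_X_pow_sub_C β three_ne_zero, by rw [← aeval_def]; simp [hu]⟩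
  have hv : v = algebraMap F Ω a / u := by rw [← hmul]; field_simp
  have hmem : u + v ∈ F⟮u⟯ := by
    rw [hv]
    exact add_mem (mem_adjoin_simple_self F u)
      (div_mem (_root_.algebraMap_mem _ a) (mem_adjoin_simple_self F u))
  have := adjoin.finiteDimensional hint
  have hint' : IsIntegral F (u + v) :=
    (Algebra.IsIntegral.isIntegral (R := F) (⟨u + v, hmem⟩ : F⟮u⟯)).map F⟮u⟯.val
  have hprime : (Module.finrank F F⟮u⟯).Prime := by
    rw [adjoin.finrank hint, hdeg]
    exact Nat.prime_three
  have := isSimpleOrder_of_finrank_prime F F⟮u⟯ hprime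
  rcases eq_bot_or_eq_top (F⟮(⟨u + v, hmem⟩ : F⟮u⟯)⟯) with h | h
  · exfalso
    rw [adjoin_simple_eq_bot_iff, mem_bot] at h
    obtain ⟨c, hc⟩ := h
    have hc' : algebraMap F Ω c = u + v := congrArg Subtype.val hc
    have h1 : algebraMap F Ω 1 * u ^ 2 + algebraMap F Ω (-c) * u + algebraMap F Ω a = 0 := by
      rw [map_one, map_neg, hc', ← hmul]
      ring
    exact one_ne_zero (eq_zero_of_quadratic_eq_zero hdeg h1).1
  · have h1 : F⟮u + v⟯ = F⟮u⟯ := by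
      have := lift_adjoin_simple (F := F) F⟮u⟯ ⟨u + v, hmem⟩
      rw [← this, h, lift_top]
    rw [← adjoin.finrank hint', h1, adjoin.finrank hint, hdeg]

theorem isSeparable_of_conjugate_ne {F E : Type*} [Field F] [Field E] [Algebra F E] {β β' : E}
    {s n : F} (hadd : β + β' = algebraMap F E s) (hmul : β * β' = algebraMap F E n)
    (hne : β ≠ β') (htop : F⟮β⟯ = ⊤) : Algebra.IsSeparable F E := by
  have hsep : IsSeparable F β := by
    have h1 : (X ^ 2 - C s * X + C n : F[X]).Separable := by
      rw [← separable_map (algebraMap F E)]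
      have h2 : (X ^ 2 - C s * X + C n : F[X]).map (algebraMap F E) = (X - C β) * (X - C β') := by
        simp only [Polynomial.map_add, Polynomial.map_sub, Polynomial.map_mul, Polynomial.map_pow,
          map_X, map_C, ← hadd, ← hmul, C_add, C_mul]
        ring
      rw [h2]
      exact (separable_X_sub_C).mul separable_X_sub_C
        (isCoprime_X_sub_C_of_isUnit_sub (sub_ne_zero.mpr hne).isUnit)
    refine h1.of_dvd (minpoly.dvd F β ?_)
    simp only [map_add, map_sub, map_mul, map_pow, aeval_X, aeval_C, ← hadd, ← hmul]
    ring
  have := (isSeparable_adjoin_simple_iff_isSeparable F E).mpr hsep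
  rw [htop] at this
  exact Algebra.IsSeparable.of_algHom _ _ (topEquiv (F := F) (E := E)).symm.toAlgHom

end Closure

/-! ### Constant extensions and cube roots of units -/

section Places

variable {k K E : Type*} [Field k] [Field K] [Algebra k K] [Field E] [Algebra k E] [Algebra K E]
  [IsScalarTower k K E]

/-- A valuation ring above a place is a place. -/
def Place.ofComapEq (p : Place k K) (W : ValuationSubring E)
    (hW : W.comap (algebraMap K E) = p.ring) : Place k E where
  ring := W
  algebraMap_mem c := by
    rw [IsScalarTower.algebraMap_apply k K E, ← ValuationSubring.mem_comap, hW]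
    exact p.algebraMap_mem c
  ne_top h := p.ne_top (by rw [← hW, h]; exact eq_top_iff.mpr fun _ _ => ValuationSubring.mem_top _)

theorem Place.exists_liesOver (p : Place k K) (E : Type*) [Field E] [Algebra k E] [Algebra K E]
    [IsScalarTower k K E] : ∃ P : Place k E, P.LiesOver p := by
  obtain ⟨W, hW⟩ := exists_valuationSubring_comap_eq E p.ring
  exact ⟨p.ofComapEq W hW, hW⟩

/-- Constant extensions are unramified if the field `k` is perfect: the minimal polynomial of a
generator of `ℓ / k` remains separable modulo every place. -/
theorem Place.not_constant_extension_of_ramificationIdx [PerfectField k]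
    [FiniteDimensional K E] (hK : IsFunctionField k K) {p : Place k K} {P : Place k E}
    (hPp : P.LiesOver p) (he : P.ramificationIdx K = 3) :
    ¬ ∃ ℓ : IntermediateField k E, Module.finrank k ℓ = 3 ∧ adjoin K (ℓ : Set E) = ⊤ := by
  rintro ⟨ℓ, hℓ, htop⟩
  have : FiniteDimensional k ℓ := Module.finite_of_finrank_pos (by omega)
  have := p.isDiscreteValuationRing hK
  have := P.isDiscreteValuationRing (hK.of_finiteDimensional (L := E))
  obtain ⟨s, -, hs⟩ := P.exists_valuation_pow_three_eq hPp he
  obtain ⟨a, ha⟩ := Field.exists_primitive_element k ℓ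
  have hadj : k⟮(a : E)⟯ = ℓ := by rw [← lift_adjoin_simple, ha, lift_top]
  have htop' : K⟮(a : E)⟯ = ⊤ := by
    rw [eq_top_iff, ← htop, adjoin_le_iff]
    have h1 : k⟮(a : E)⟯ ≤ K⟮(a : E)⟯.restrictScalars k :=
      adjoin_simple_le_iff.mpr (mem_adjoin_simple_self K (a : E))
    rw [hadj] at h1
    exact h1
  have haint : IsIntegral k (a : E) := (Algebra.IsIntegral.isIntegral (R := k) a).map ℓ.val
  have hst : IsScalarTower k p.ring K := IsScalarTower.of_algebraMap_eq fun _ => rfl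
  have heval : ∀ f : k[X], (f.map (algebraMap k p.ring)).eval₂
      ((algebraMap K E).comp p.ring.subtype) (a : E) = aeval (a : E) f := by
    intro f
    rw [eval₂_map, aeval_def, IsScalarTower.algebraMap_eq k K E]
    rfl
  have hsep : aeval (a : E) (minpoly k (a : E)).derivative ≠ 0 :=
    (PerfectField.separable_of_irreducible (minpoly.irreducible haint)).aeval_derivative_ne_zero
      (minpoly.aeval k _)
  have hamem : (a : E) ∈ P.ring := by
    rcases eq_or_ne (a : E) 0 with h | h
    · rw [h]
      exact P.ring.zero_mem
    · rw [← ValuationSubring.valuation_le_one_iff]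
      exact (P.valuation_eq_one_of_isAlgebraic haint.isAlgebraic h).le
  obtain ⟨c, hc⟩ := exists_valuation_eq_of_simple_root (F := K) hPp hamem
    (f := (minpoly k (a : E)).map (algebraMap k p.ring)) (by rw [heval, minpoly.aeval])
    (by
      rw [derivative_map, heval]
      refine P.valuation_eq_one_of_isAlgebraic ?_ hsep
      have h1 := (Algebra.IsIntegral.isIntegral (R := k)
        (aeval a (minpoly k (a : E)).derivative)).map ℓ.val
      rw [← aeval_algHom_apply] at h1
      exact h1.isAlgebraic)
    (x := s) (by rw [htop']; trivial)
  exact hs c hc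

end Places

section Ramification

variable {k K Ω : Type*} [Field k] [Field K] [Algebra k K] [Field Ω] [Algebra K Ω] [Algebra k Ω]
  [IsScalarTower k K Ω] [Algebra.IsAlgebraic K Ω]

/-- In characteristic different from three, no ramification of index three takes place in a cubic
extension contained in `K'(u)`, where `K'` is quadratic over `K`, and where `u ^ 3` lies in `K'` and
is a unit. -/
theorem Place.ramificationIdx_ne_three (hK : IsFunctionField k K) (h3 : (3 : k) ≠ 0)
    {L K' : IntermediateField K Ω} [FiniteDimensional K L] (hquad : Module.finrank K K' = 2)
    {P : Place k L} {p : Place k K} (hPp : P.LiesOver p) {W : ValuationSubring Ω}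
    (hW : W.comap (algebraMap L Ω) = P.ring) {u : Ω} {β : K'} (hu : u ^ 3 = β)
    (hu1 : W.valuation u = 1) (hL : ∀ s : L, (s : Ω) ∈ K'⟮u⟯) : P.ramificationIdx K ≠ 3 := by
  intro he
  have : FiniteDimensional K K' := Module.finite_of_finrank_pos (by omega)
  have := p.isDiscreteValuationRing hK
  have := P.isDiscreteValuationRing (hK.of_finiteDimensional (L := L))
  have hWp : W.comap (algebraMap K Ω) = p.ring := by rw [← hPp, ← hW]; rfl
  let Q : Place k K' := p.ofComapEq (W.comap (algebraMap K' Ω)) hWp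
  have := Q.isDiscreteValuationRing (hK.of_finiteDimensional (L := K'))
  have halg : Algebra.IsAlgebraic K' Ω := Algebra.IsAlgebraic.tower_top (K := K) K'
  obtain ⟨s, ⟨t, ht⟩, hs⟩ := P.exists_valuation_pow_three_eq hPp he
  have hβ : β ∈ Q.ring := by
    change (β : Ω) ∈ W
    rw [← ValuationSubring.valuation_le_one_iff, ← hu, map_pow, hu1, one_pow]
  have h3W : W.valuation (3 : Ω) = 1 := by
    have hk : W = ((p.ofComapEq W hWp : Place k Ω)).ring := rfl
    rw [hk, ← map_ofNat (algebraMap k Ω) 3]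
    exact Place.valuation_algebraMap _ h3
  obtain ⟨c, hc⟩ := exists_valuation_eq_of_simple_root (F := K') (A := Q.ring) (B := W) rfl
    (u := u) (f := X ^ 3 - C ⟨β, hβ⟩)
    (by rw [← ValuationSubring.valuation_le_one_iff, hu1])
    (by
      rw [eval₂_sub, eval₂_X_pow, eval₂_C, hu]
      exact sub_self _)
    (by
      have h1 : (X ^ 3 - C ⟨β, hβ⟩ : Q.ring[X]).derivative = 3 * X ^ 2 := by
        rw [derivative_sub, derivative_X_pow, derivative_C, sub_zero]
        norm_num
        exact map_ofNat C 3
      rw [h1, eval₂_mul, eval₂_X_pow, eval₂_ofNat, map_mul, map_pow, hu1, h3W, one_pow, one_mul])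
    (hL s)
  have hs3 : W.valuation (s : Ω) ^ 3 = W.valuation (algebraMap K Ω t) := by
    rw [← map_pow] at ht
    rw [← map_pow]
    exact (valuation_eq_iff_of_comap_eq hW (s ^ 3) (algebraMap K L t)).mpr ht
  have hdeg : (minpoly K (c : Ω)).natDegree ≤ 2 := by
    rw [← hquad]
    have h1 := minpoly.natDegree_le (A := K) c
    rwa [← minpoly.algebraMap_eq (algebraMap K' Ω).injective c] at h1
  -- The value of `s` is taken on `K'`, and its triple on `K`; so it is taken on `K`.
  obtain ⟨d, hd⟩ := exists_valuation_eq_of_pow_three W.valuation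
    (Algebra.IsIntegral.isIntegral (R := K) (c : Ω)) hdeg (c := t) (by rw [← hs3, hc]; rfl)
  refine hs d ((valuation_eq_iff_of_comap_eq hW s (algebraMap K L d)).mp ?_)
  exact hc.trans hd

/-- If the places above `p` are totally ramified in a cubic extension with quadratic purely cubic
closure `K'`, then `p` splits in `K'`. Otherwise the radicands of Cardano's formula, which are
conjugate and have a cube as their product, have the same value at the only place above `p`; so
up to a cube they are units. -/
theorem Place.splitsIn_of_isTotallyRamifiedIn (hK : IsFunctionField k K) (h3 : (3 : k) ≠ 0)
    {L K' : IntermediateField K Ω} (hL : Module.finrank K L = 3)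
    (hquad : Module.finrank K K' = 2) (hcl : IsPurelyCubicClosure L K') {p : Place k K}
    (hp : p.IsTotallyRamifiedIn L) : p.SplitsIn K' := by
  have : FiniteDimensional K K' := Module.finite_of_finrank_pos (by omega)
  have : FiniteDimensional K L := Module.finite_of_finrank_pos (by omega)
  have h3K : (3 : K) ≠ 0 := by
    rw [← map_ofNat (algebraMap k K) 3]
    simpa using h3
  obtain ⟨u, v, a, b, β, β', hadj, hmul, hu, hv, hadd, hprod, hne, hnot⟩ :=
    hcl.exists_cardano h3K hL hquad
  have := isSimpleOrder_of_finrank_prime K K' (hquad ▸ Nat.prime_two)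
  have htop : K⟮β⟯ = ⊤ :=
    (eq_bot_or_eq_top K⟮β⟯).resolve_left fun h => hnot (h ▸ mem_adjoin_simple_self K β)
  have hprod' : β * β' = algebraMap K K' (a ^ 3) := by rw [hprod, map_pow]
  have := isSeparable_of_conjugate_ne hadd hprod' hne htop
  obtain ⟨σ, hσ⟩ := exists_isConjugation (K := K) (K' := K') hquad
  have hβ0 : β ≠ 0 := by
    rintro rfl
    exact hnot (zero_mem _)
  -- Both `σ β` and `β'` are determined by the minimal polynomial of `β`.
  have hσβ : σ β = β' := by
    obtain ⟨s, hs⟩ := hσ.trace_mem β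
    obtain ⟨n, hn⟩ := hσ.norm_mem β
    have h1 : (algebraMap K K' (s - b)) * β = algebraMap K K' (n - a ^ 3) := by
      rw [map_sub, map_sub, hs, hn, ← hadd, ← hprod']
      ring
    by_cases hsb : s = b
    · rw [hsb, ← hadd] at hs
      exact (add_left_cancel hs).symm
    · refine absurd ?_ hnot
      have h2 : algebraMap K K' (s - b) ≠ 0 := by
        simpa [sub_eq_zero] using hsb
      rw [mem_bot]
      refine ⟨(n - a ^ 3) / (s - b), ?_⟩
      rw [map_div₀, ← h1, mul_div_cancel_left₀ _ h2]
  have hβ'0 : β' ≠ 0 := by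
    rw [← hσβ]
    simpa using hβ0
  obtain ⟨P, hPp, he⟩ := hp
  obtain ⟨W, hW⟩ := exists_valuationSubring_comap_eq Ω P.ring
  have hWp : W.comap (algebraMap K Ω) = p.ring := by rw [← hPp, ← hW]; rfl
  let Q : Place k K' := p.ofComapEq (W.comap (algebraMap K' Ω)) hWp
  have := Q.isDiscreteValuationRing (hK.of_finiteDimensional (L := K'))
  have := (Q.conj σ).isDiscreteValuationRing (hK.of_finiteDimensional (L := K'))
  rw [Place.splitsIn_iff hσ hquad (P := Q) hWp]
  intro hconj
  -- A conjugation-invariant valuation ring contains `β' / β` along with its inverse, the conjugate.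
  have hval : Q.ring.valuation (β' / β) = 1 := by
    have hσx : σ (β' / β) = (β' / β)⁻¹ := by
      rw [map_div₀, ← hσβ, hσ.apply_apply, inv_div]
    have hiff : β' / β ∈ Q.ring ↔ (β' / β)⁻¹ ∈ Q.ring := by
      rw [← hσx, ← Place.mem_conj, hconj]
    have h1 : β' / β ∈ Q.ring := (Q.ring.mem_or_inv_mem _).elim id hiff.mpr
    refine le_antisymm ((Q.ring.valuation_le_one_iff _).mpr h1) ?_
    rw [Valuation.one_le_val_iff _ (div_ne_zero hβ'0 hβ0), ValuationSubring.valuation_le_one_iff]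
    exact hiff.mp h1
  have ha0 : algebraMap K K' a ≠ 0 := by
    intro h
    rw [h, zero_pow three_ne_zero] at hprod
    exact mul_ne_zero hβ0 hβ'0 hprod
  -- The cube of `β / a` differs from `β` by the unit `β' / β`, as `β * β' = a ^ 3`.
  set c : K' := β / algebraMap K K' a with hc
  have hc0 : c ≠ 0 := div_ne_zero hβ0 ha0
  have hc0' : (c : Ω) ≠ 0 := by simpa using hc0
  have hunit : β / c ^ 3 = β' / β := by
    rw [hc, div_pow, ← hprod]
    field_simp
  have hu3 : (u / c) ^ 3 = ((β' / β : K') : Ω) := by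
    rw [← hunit, div_pow, ← hu]
    rfl
  have hu1 : W.valuation (u / c) = 1 := by
    have h1 : W.valuation (u / c) ^ 3 = 1 := by
      rw [← map_pow, hu3]
      have h2 := (valuation_eq_iff_of_comap_eq (A := Q.ring) (B := W) rfl (β' / β) 1).mpr
        (by rw [hval, map_one])
      rw [map_one, map_one] at h2
      exact h2
    exact (pow_eq_one_iff_of_nonneg zero_le three_ne_zero).mp h1
  refine P.ramificationIdx_ne_three hK h3 hquad hPp hW hu3 hu1 (fun s => ?_) (he.trans hL)
  have hmemu : u ∈ K'⟮u / c⟯ := by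
    have h1 : u = u / c * algebraMap K' Ω c := by
      change u = u / c * (c : Ω)
      field_simp
    have h2 := mul_mem (mem_adjoin_simple_self K' (u / c))
      (IntermediateField.algebraMap_mem K'⟮u / c⟯ c)
    rwa [← h1] at h2
  have hu0 : u ≠ 0 := by
    rintro rfl
    rw [zero_pow three_ne_zero] at hu
    exact hβ0 (Subtype.ext hu)
  have hmem : u + v ∈ K'⟮u / c⟯.restrictScalars K := by
    refine add_mem hmemu ?_
    have h1 : v = algebraMap K' Ω (algebraMap K K' a) / u := by
      change v = algebraMap K Ω a / u
      rw [← hmul]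
      field_simp
    rw [h1]
    exact div_mem (IntermediateField.algebraMap_mem K'⟮u / c⟯ _) hmemu
  exact (adjoin_simple_le_iff.mpr hmem) (hadj.ge s.2)

end Ramification

/-! ### Functions with conjugate zeros and poles -/

section Constants

variable {k F : Type*} [Field k] [Field F] [Algebra k F]

/-- A function field over `k` is one over its field of constants. -/
theorem IsFunctionField.algebraicClosure (hF : IsFunctionField k F) :
    IsFunctionField (algebraicClosure k F) F := by
  obtain ⟨x, hx, hfin⟩ := hF
  refine ⟨x, hx.algebraicClosure, ?_⟩
  have hle : k⟮x⟯ ≤ (_root_.algebraicClosure k F)⟮x⟯.restrictScalars k :=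
    adjoin_simple_le_iff.mpr (mem_adjoin_simple_self _ x)
  let _ := (inclusion hle).toRingHom.toAlgebra
  have : IsScalarTower k⟮x⟯ ((_root_.algebraicClosure k F)⟮x⟯.restrictScalars k) F :=
    IsScalarTower.of_algebraMap_eq fun _ => rfl
  exact Module.Finite.of_restrictScalars_finite k⟮x⟯
    ((_root_.algebraicClosure k F)⟮x⟯.restrictScalars k) F

/-- A place over `k`, viewed as a place over the field of constants. -/
def Place.overConstants (P : Place k F) : Place (algebraicClosure k F) F where
  ring := P.ring
  algebraMap_mem c := by
    rcases eq_or_ne (algebraMap (algebraicClosure k F) F c) 0 with h | h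
    · rw [h]
      exact P.ring.zero_mem
    · rw [← ValuationSubring.valuation_le_one_iff]
      exact (P.valuation_eq_one_of_isAlgebraic (mem_algebraicClosure_iff.mp c.2) h).le
  ne_top := P.ne_top

theorem Place.overConstants_injective :
    Function.Injective (Place.overConstants : Place k F → Place (algebraicClosure k F) F) :=
  fun _ _ h => Place.ext (congrArg (fun R : Place (algebraicClosure k F) F => R.ring) h)

variable {K : Type*} [Field K] [Algebra k K] [Algebra K F] [IsScalarTower k K F]

theorem Place.conj_conj {σ : F ≃ₐ[K] F} (hσ : ∀ x, σ (σ x) = x) (P : Place k F) :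
    (P.conj σ).conj σ = P := by
  ext x
  rw [Place.mem_conj, Place.mem_conj, hσ]

/-- Conjugate places have conjugate residue fields; as the conjugation moves the constants, this
isomorphism is only semilinear. -/
theorem Place.degree_overConstants_conj (σ : F ≃ₐ[K] F) (P : Place k F) :
    (P.conj σ).overConstants.degree = P.overConstants.degree := by
  let e : (P.conj σ).overConstants.ring ≃+* P.overConstants.ring :=
    { toFun := fun x => ⟨σ x, x.2⟩
      invFun := fun x => ⟨σ.symm x, by
        change σ (σ.symm x) ∈ P.ring
        rw [σ.apply_symm_apply]
        exact x.2⟩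
      left_inv := fun x => Subtype.ext (σ.symm_apply_apply _)
      right_inv := fun x => Subtype.ext (σ.apply_symm_apply _)
      map_mul' := fun x y => Subtype.ext (map_mul σ _ _)
      map_add' := fun x y => Subtype.ext (map_add σ _ _) }
  exact Algebra.finrank_eq_of_equiv_equiv
    (algebraicClosure.algEquivOfAlgEquiv (σ.restrictScalars k)).toRingEquiv
    (ResidueField.mapEquiv e) (RingHom.ext fun c => congrArg (residue _) (Subtype.ext rfl))

omit [IsScalarTower k K F] in
theorem Place.LiesOver.unique {P : Place k F} {p q : Place k K} (hp : P.LiesOver p)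
    (hq : P.LiesOver q) : p = q :=
  Place.ext (hp.symm.trans hq)

/-- In genus zero, the divisor that is the difference of two distinct conjugate places is
principal. -/
theorem HasGenus.exists_valuation_conj (hF : IsFunctionField k F)
    (hg : HasGenus (algebraicClosure k F) F 0) {σ : F ≃ₐ[K] F} (hσ : ∀ x, σ (σ x) = x)
    {P : Place k F} (hP : P.conj σ ≠ P) {s : P.ring} (hs : maximalIdeal P.ring = Ideal.span {s}) :
    ∃ γ : F, γ ≠ 0 ∧ P.ring.valuation γ = P.ring.valuation s ∧
      P.ring.valuation (σ γ) = (P.ring.valuation s)⁻¹ ∧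
      ∀ Q : Place k F, Q ≠ P → Q ≠ P.conj σ →
        Q.ring.valuation γ = 1 ∧ Q.ring.valuation (σ γ) = 1 := by
  have hdvr := fun R : Place (algebraicClosure k F) F =>
    R.isDiscreteValuationRing hF.algebraicClosure
  have hpos : ∀ R : Place (algebraicClosure k F) F, 0 < R.degree := fun R => by
    have := R.finite_residueField hF.algebraicClosure
    exact Module.finrank_pos
  let t : (P.conj σ).ring := ⟨σ s, by rw [Place.mem_conj, hσ]; exact s.2⟩
  have ht : maximalIdeal (P.conj σ).ring = Ideal.span {t} := by
    rw [ValuationSubring.maximalIdeal_eq_span_iff] at hs ⊢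
    have hlt : ∀ x y : F, (P.conj σ).ring.valuation x < (P.conj σ).ring.valuation y ↔
        P.ring.valuation (σ x) < P.ring.valuation (σ y) := fun x y => by
      rw [← not_le, ← P.valuation_conj_le_iff, not_le]
    have hts : σ t = s := hσ s
    refine ⟨?_, fun x hx => ?_⟩
    · rw [← map_one (P.conj σ).ring.valuation, hlt, hts, map_one, map_one]
      exact hs.1
    · rw [← P.valuation_conj_le_iff, hts]
      refine hs.2 _ ?_
      rwa [← map_one (P.conj σ).ring.valuation, hlt, map_one, map_one] at hx
  obtain ⟨γ, hγ0, h1, h2, h3⟩ := hg.exists_valuation_eq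
    (P := P.overConstants) (Q := (P.conj σ).overConstants)
    (fun h => hP (Place.overConstants_injective h).symm) (P.degree_overConstants_conj σ).symm hpos
    hs ht
  have h3' : ∀ Q : Place k F, Q ≠ P → Q ≠ P.conj σ → Q.ring.valuation γ = 1 := fun Q hQ hQ' =>
    h3 Q.overConstants (fun h => hQ (Place.overConstants_injective h))
      (fun h => hQ' (Place.overConstants_injective h))
  have ht0 : (P.conj σ).ring.valuation (t : F) ≠ 0 := by
    intro h
    have h4 : (P.conj σ).ring.valuation γ = ((P.conj σ).ring.valuation (t : F))⁻¹ := h2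
    rw [h, inv_zero, Valuation.zero_iff] at h4
    exact hγ0 h4
  refine ⟨γ, hγ0, h1, ?_, fun Q hQ hQ' => ⟨h3' Q hQ hQ', ?_⟩⟩
  · have h4 : (P.conj σ).ring.valuation (γ * t) = (P.conj σ).ring.valuation 1 := by
      have h5 : (P.conj σ).ring.valuation γ = ((P.conj σ).ring.valuation (t : F))⁻¹ := h2
      rw [map_mul, h5, inv_mul_cancel₀ ht0, map_one]
    rw [← P.valuation_conj_eq_iff, map_mul, map_one, map_mul, map_one,
      show σ (t : F) = s from hσ s] at h4
    exact eq_inv_of_mul_eq_one_left h4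
  · have h4 := h3' (Q.conj σ) (fun h => hQ' (by rw [← h, Q.conj_conj hσ]))
      (fun h => hQ (by rw [← Q.conj_conj hσ, h, P.conj_conj hσ]))
    rw [← map_one (Q.conj σ).ring.valuation, ← Q.valuation_conj_eq_iff, map_one, map_one] at h4
    exact h4

/-- In genus zero, there is a function with a simple zero and a simple pole at the two places above
each point of a finite set of split places, and without other zeros and poles. -/
theorem HasGenus.exists_valuation_of_splitsIn [FiniteDimensional K F] (hK : IsFunctionField k K)
    (hg : HasGenus (algebraicClosure k F) F 0) (hquad : Module.finrank K F = 2) {σ : F ≃ₐ[K] F}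
    (hσ : IsConjugation σ) {T : Set (Place k K)} (hT : T.Finite)
    (hsplit : ∀ p ∈ T, p.SplitsIn F) :
    ∃ γ : F, γ ≠ 0 ∧
      (∀ p ∈ T, ∃ (P : Place k F) (s : P.ring), P.LiesOver p ∧
        maximalIdeal P.ring = Ideal.span {s} ∧ (s : F) ≠ 0 ∧
        P.ring.valuation γ = P.ring.valuation s ∧
        P.ring.valuation (σ γ) = (P.ring.valuation s)⁻¹) ∧
      ∀ (Q : Place k F) (p : Place k K), Q.LiesOver p → p ∉ T →
        Q.ring.valuation γ = 1 ∧ Q.ring.valuation (σ γ) = 1 := by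
  classical
  have hF := hK.of_finiteDimensional (L := F)
  have key : ∀ p ∈ T, ∃ γ : F, γ ≠ 0 ∧
      (∃ (P : Place k F) (s : P.ring), P.LiesOver p ∧
        maximalIdeal P.ring = Ideal.span {s} ∧ (s : F) ≠ 0 ∧
        P.ring.valuation γ = P.ring.valuation s ∧
        P.ring.valuation (σ γ) = (P.ring.valuation s)⁻¹) ∧
      ∀ Q : Place k F, ¬ Q.LiesOver p →
        Q.ring.valuation γ = 1 ∧ Q.ring.valuation (σ γ) = 1 := by
    intro p hp
    obtain ⟨P, hP⟩ := p.exists_liesOver F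
    have := P.isDiscreteValuationRing hF
    have := (P.conj σ).isDiscreteValuationRing hF
    obtain ⟨s, hs, hs0⟩ := P.ring.exists_uniformizer
    obtain ⟨γ, h0, h1, h2, h3⟩ := hg.exists_valuation_conj hF hσ.apply_apply
      ((Place.splitsIn_iff hσ hquad hP).mp (hsplit p hp)) hs
    refine ⟨γ, h0, ⟨P, s, hP, hs, hs0, h1, h2⟩, fun Q hQ => h3 Q ?_ ?_⟩
    · rintro rfl
      exact hQ hP
    · rintro rfl
      exact hQ (hP.conj σ)
  choose! γ h0 h1 h2 using key
  refine ⟨∏ p ∈ hT.toFinset, γ p, ?_, fun p hp => ?_, fun Q p hQ hp => ?_⟩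
  · exact Finset.prod_ne_zero_iff.mpr fun p hp => h0 p (hT.mem_toFinset.mp hp)
  · obtain ⟨P, s, hP, hs, hs0, h3, h4⟩ := h1 p hp
    have hone : ∀ q ∈ hT.toFinset, q ≠ p → P.ring.valuation (γ q) = 1 ∧
        P.ring.valuation (σ (γ q)) = 1 := fun q hq hqp =>
      h2 q (hT.mem_toFinset.mp hq) P fun h => hqp (h.unique hP)
    have hp' : p ∉ hT.toFinset → False := fun h => h (hT.mem_toFinset.mpr hp)
    refine ⟨P, s, hP, hs, hs0, ?_, ?_⟩
    · rw [map_prod, Finset.prod_eq_single p (fun q hq hqp => (hone q hq hqp).1)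
        (fun h => (hp' h).elim), h3]
    · rw [map_prod, map_prod, Finset.prod_eq_single p (fun q hq hqp => (hone q hq hqp).2)
        (fun h => (hp' h).elim), h4]
  · have hone : ∀ q ∈ hT.toFinset, Q.ring.valuation (γ q) = 1 ∧
        Q.ring.valuation (σ (γ q)) = 1 := fun q hq =>
      h2 q (hT.mem_toFinset.mp hq) Q fun h => hp (h.unique hQ ▸ hT.mem_toFinset.mp hq)
    rw [map_prod, map_prod, map_prod]
    exact ⟨Finset.prod_eq_one fun q hq => (hone q hq).1,
      Finset.prod_eq_one fun q hq => (hone q hq).2⟩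

end Constants

/-! ### Total ramification at simple poles -/

section TotalRamification

variable {k K L : Type*} [Field k] [Field K] [Field L] [Algebra k K] [Algebra k L] [Algebra K L]
  [IsScalarTower k K L]

/-- At a simple pole of `b`, a root `θ` of `X ^ 3 - 3 a X - b`, with `a` integral, satisfies
`v θ ^ 3 = v b`, which forces ramification of index three. -/
theorem Place.ramificationIdx_eq_three_of_root (hK : IsFunctionField k K)
    (hL : Module.finrank K L = 3) {p : Place k K} {P : Place k L} (hPp : P.LiesOver p) {θ : L}
    {a b : K} (hroot : θ ^ 3 = 3 * algebraMap K L a * θ + algebraMap K L b)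
    (ha : p.ring.valuation a ≤ 1) {t : p.ring} (ht : maximalIdeal p.ring = Ideal.span {t})
    (ht0 : (t : K) ≠ 0) (hb : p.ring.valuation b = (p.ring.valuation t)⁻¹) :
    P.ramificationIdx K = 3 := by
  have : FiniteDimensional K L := Module.finite_of_finrank_pos (by omega)
  have := p.isDiscreteValuationRing hK
  have := P.isDiscreteValuationRing (hK.of_finiteDimensional (L := L))
  obtain ⟨s, hs, hs0⟩ := P.ring.exists_uniformizer
  have ht1 := ((p.ring.maximalIdeal_eq_span_iff t).mp ht).1
  have hs1 := ((P.ring.maximalIdeal_eq_span_iff s).mp hs).1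
  have hspos : 0 < P.ring.valuation (s : L) := zero_lt_iff.mpr ((Valuation.ne_zero_iff _).mpr hs0)
  have htpos : 0 < p.ring.valuation (t : K) := zero_lt_iff.mpr ((Valuation.ne_zero_iff _).mpr ht0)
  have hle : ∀ c : K, p.ring.valuation c ≤ 1 → P.ring.valuation (algebraMap K L c) ≤ 1 := by
    intro c hc
    have := (valuation_le_iff_of_comap_eq hPp c 1).mpr (by rwa [map_one])
    rwa [map_one, map_one] at this
  have h3a : P.ring.valuation (3 * algebraMap K L a) ≤ 1 := by
    rw [map_mul]
    exact mul_le_one₀ (by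
      rw [← map_ofNat (algebraMap k L) 3]
      exact P.valuation_algebraMap_le 3) zero_le (hle a ha)
  have hb1 : 1 < P.ring.valuation (algebraMap K L b) := by
    have h1 := (valuation_lt_iff_of_comap_eq hPp 1 b).mpr (by
      rw [hb, map_one]
      exact (one_lt_inv₀ htpos).mpr ht1)
    rwa [map_one, map_one] at h1
  have hθ1 : 1 < P.ring.valuation θ := by
    by_contra! h
    have h1 : algebraMap K L b = θ ^ 3 - 3 * algebraMap K L a * θ := by rw [hroot]; ring
    refine absurd hb1 (not_lt.mpr ?_)
    rw [h1]
    refine P.ring.valuation.map_sub_le ?_ ?_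
    · rw [map_pow]
      exact pow_le_one₀ zero_le h
    · rw [map_mul]
      exact mul_le_one₀ h3a zero_le h
  have hθb : P.ring.valuation (algebraMap K L b) = P.ring.valuation θ ^ 3 := by
    have h1 : algebraMap K L b = θ ^ 3 - 3 * algebraMap K L a * θ := by rw [hroot]; ring
    rw [h1, Valuation.map_sub_eq_of_lt_left, map_pow]
    rw [map_mul, map_pow]
    calc P.ring.valuation (3 * algebraMap K L a) * P.ring.valuation θ ≤ P.ring.valuation θ :=
          mul_le_of_le_one_left zero_le h3a
      _ < P.ring.valuation θ ^ 3 := by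
          conv_lhs => rw [← pow_one (P.ring.valuation θ)]
          exact pow_lt_pow_right₀ hθ1 (by norm_num)
  have hθ0 : θ ≠ 0 := by
    rintro rfl
    simp at hθ1
  obtain ⟨j, hj⟩ := P.ring.exists_valuation_eq_pow hs (inv_ne_zero hθ0)
    (by rw [map_inv₀]; exact inv_le_one_of_one_le₀ hθ1.le)
  have hts : P.ring.valuation (algebraMap K L t) = P.ring.valuation s ^ (3 * j) := by
    have h1 : P.ring.valuation (algebraMap K L (t : K)) =
        P.ring.valuation (algebraMap K L b⁻¹) := by
      rw [valuation_eq_iff_of_comap_eq hPp, map_inv₀, hb, inv_inv]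
    rw [h1, map_inv₀, map_inv₀, hθb, ← inv_pow, ← map_inv₀, hj, ← pow_mul, mul_comm]
  -- A multiple `m ≤ 3` of the value of `s` is taken on `K`, hence divisible by `3 * j`.
  have hinj := (pow_right_strictAnti₀ hspos hs1).injective
  obtain ⟨m, hm1, hm, c, hc⟩ := exists_valuation_pow_eq P.ring.valuation
    (Algebra.IsIntegral.isIntegral (R := K) (s : L))
  have hm3 : m ≤ 3 := hm.trans (hL ▸ minpoly.natDegree_le (A := K) (s : L))
  have hc0 : c ≠ 0 := by
    rintro rfl
    rw [map_zero, map_zero] at hc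
    exact (pow_pos hspos m).ne' hc
  have hc1 : p.ring.valuation c ≤ 1 := by
    have h1 := (valuation_le_iff_of_comap_eq hPp c 1).mp (by
      rw [← hc, map_one, map_one]
      exact pow_le_one₀ zero_le hs1.le)
    rwa [map_one] at h1
  obtain ⟨n, hn⟩ := p.ring.exists_valuation_eq_pow ht hc0 hc1
  have hmn : m = 3 * j * n := by
    refine hinj ?_
    change P.ring.valuation (s : L) ^ m = P.ring.valuation (s : L) ^ (3 * j * n)
    rw [hc, pow_mul, ← hts, ← map_pow, ← map_pow, valuation_eq_iff_of_comap_eq hPp, hn, map_pow]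
  have hj1 : j = 1 := by
    have h1 : 0 < j * n := by
      by_contra! h
      rw [mul_assoc, Nat.le_zero.mp h] at hmn
      omega
    have h2 : j * n ≤ 1 := by
      rw [mul_assoc] at hmn
      omega
    exact Nat.eq_one_of_mul_eq_one_right (m := j) (n := n) (by omega)
  exact Place.ramificationIdx_eq hPp ht ht0 hs (by rw [hts, hj1])

end TotalRamification

/-! ### Construction of the cubic extension -/

section Construction

variable {k K Ω : Type*} [Field k] [Field K] [Algebra k K] [Field Ω] [Algebra K Ω] [Algebra k Ω]
  [IsScalarTower k K Ω]

theorem isSeparable_adjoin_of_natDegree_eq_three (h3 : (3 : K) ≠ 0) {θ : Ω}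
    (hdeg : (minpoly K θ).natDegree = 3) : Algebra.IsSeparable K K⟮θ⟯ := by
  have hint : IsIntegral K θ := by
    by_contra h
    rw [minpoly.eq_zero h, natDegree_zero] at hdeg
    omega
  rw [isSeparable_adjoin_simple_iff_isSeparable]
  refine (separable_iff_derivative_ne_zero (minpoly.irreducible hint)).mpr fun h => ?_
  have h1 : (minpoly K θ).derivative.coeff 2 = (minpoly K θ).leadingCoeff * ((2 : ℕ) + 1) := by
    rw [coeff_derivative, leadingCoeff, hdeg]
  rw [h, coeff_zero, minpoly.monic hint, one_mul] at h1
  refine h3 ?_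
  rw [h1]
  norm_num

/-- Cardano's formula for the radicands `γ ^ 2 * σ γ` and `γ * σ γ ^ 2`, where `γ` has a simple zero
and a simple pole at the two places above each point of `T`, and no other zeros and poles. -/
theorem exists_isCubicExtension_of_splitsIn [PerfectField k] [IsAlgClosed Ω]
    [Algebra.IsAlgebraic K Ω] (hK : IsFunctionField k K) (h3 : (3 : k) ≠ 0)
    {K' : IntermediateField K Ω} (hquad : Module.finrank K K' = 2)
    (hg : HasGenus (algebraicClosure k K') K' 0) {T : Set (Place k K)} (hT : T.Finite)
    (hTne : T.Nonempty) (hsplit : ∀ p ∈ T, p.SplitsIn K') :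
    ∃ L : IntermediateField K Ω, IsCubicExtension k K L ∧ IsPurelyCubicClosure L K' ∧
      ∀ p : Place k K, p.IsTotallyRamifiedIn L ↔ p ∈ T := by
  have : FiniteDimensional K K' := Module.finite_of_finrank_pos (by omega)
  have hK' := hK.of_finiteDimensional (L := K')
  have h3K : (3 : K) ≠ 0 := by
    rw [← map_ofNat (algebraMap k K) 3]
    simpa using h3
  obtain ⟨p₀, hp₀⟩ := hTne
  have hsep : Algebra.IsSeparable K K' := by
    refine (isSeparable_or_isPurelyInseparable_of_finrank_prime
      (hquad ▸ Nat.prime_two)).resolve_right fun hins => ?_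
    have h1 := hsplit p₀ hp₀
    rw [Place.SplitsIn, hquad] at h1
    have h2 : {P : Place k K' | P.LiesOver p₀}.Subsingleton := fun P hP Q hQ =>
      Place.eq_of_liesOver_of_isPurelyInseparable hP hQ
    have h3 : {P : Place k K' | P.LiesOver p₀}.ncard ≤ 1 :=
      (Set.ncard_le_one h2.finite).mpr fun _ hP _ hQ => h2 hP hQ
    omega
  obtain ⟨σ, hσ⟩ := exists_isConjugation (K := K) (K' := K') hquad
  obtain ⟨γ, hγ0, hγT, hγ1⟩ := hg.exists_valuation_of_splitsIn hK hquad hσ hT hsplit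
  obtain ⟨a, ha⟩ := hσ.norm_mem γ
  set β : K' := γ ^ 2 * σ γ with hβ
  have hσβ : σ β = γ * σ γ ^ 2 := by
    rw [hβ, map_mul, map_pow, hσ.apply_apply, mul_comm]
  obtain ⟨b, hb⟩ := hσ.trace_mem β
  have hσγ0 : σ γ ≠ 0 := by simpa using hγ0
  have hβ0 : β ≠ 0 := mul_ne_zero (pow_ne_zero _ hγ0) hσγ0
  obtain ⟨u, hu⟩ := IsAlgClosed.exists_pow_nat_eq (β : Ω) three_pos
  have hu0 : u ≠ 0 := by
    rintro rfl
    rw [zero_pow three_ne_zero] at hu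
    exact hβ0 (Subtype.ext hu.symm)
  set v : Ω := algebraMap K Ω a / u with hv
  have hmul : u * v = algebraMap K Ω a := mul_div_cancel₀ _ hu0
  have hv3 : ((σ β : K') : Ω) = v ^ 3 := by
    have h1 : ((algebraMap K K' a : K') : Ω) = algebraMap K Ω a := rfl
    have h2 : σ β * β = algebraMap K K' a ^ 3 := by
      rw [hσβ, hβ, ha]
      ring
    rw [hv, div_pow, hu, ← h1, eq_div_iff (by simpa using hβ0)]
    exact congrArg Subtype.val h2
  have hbΩ : u ^ 3 + v ^ 3 = algebraMap K Ω b := by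
    rw [hu, ← hv3]
    exact congrArg Subtype.val hb.symm
  -- The values at a place above a point of `T`.
  have hvalβ : ∀ {P : Place k K'} {x : P.ring}, (x : K') ≠ 0 →
      P.ring.valuation γ = P.ring.valuation x →
      P.ring.valuation (σ γ) = (P.ring.valuation x)⁻¹ → P.ring.valuation β = P.ring.valuation x ∧
        P.ring.valuation (σ β) = (P.ring.valuation x)⁻¹ := by
    intro P x hx0 h1 h2
    have hx : P.ring.valuation (x : K') ≠ 0 := (Valuation.ne_zero_iff _).mpr hx0
    rw [hσβ, hβ, map_mul, map_mul, map_pow, map_pow, h1, h2]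
    constructor <;> field_simp
  obtain ⟨P₀, s₀, hP₀, hs₀, hs₀0, hγs, hσγs⟩ := hγT p₀ hp₀
  obtain ⟨hβs, hσβs⟩ := hvalβ hs₀0 hγs hσγs
  obtain ⟨hs₀1, hs₀max⟩ := (P₀.ring.maximalIdeal_eq_span_iff s₀).mp hs₀
  have hs₀pos : 0 < P₀.ring.valuation (s₀ : K') :=
    zero_lt_iff.mpr ((Valuation.ne_zero_iff _).mpr hs₀0)
  -- Since `β` has a zero where its conjugate has a pole, it does not lie in `K`.
  have htop : K⟮β⟯ = ⊤ := by
    have := isSimpleOrder_of_finrank_prime K K' (hquad ▸ Nat.prime_two)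
    refine (eq_bot_or_eq_top K⟮β⟯).resolve_left fun h => ?_
    obtain ⟨c, hc⟩ := mem_bot.mp (h ▸ mem_adjoin_simple_self K β)
    have h1 : σ β = β := by rw [← hc, σ.commutes]
    rw [h1, hβs] at hσβs
    exact (hs₀1.trans ((one_lt_inv₀ hs₀pos).mpr hs₀1)).ne hσβs
  -- A simple zero shows that `β` is not a cube.
  have hcube : ∀ c : K', c ^ 3 ≠ β := by
    intro c hc
    rw [← hc, map_pow] at hβs
    have hc1 : P₀.ring.valuation c < 1 := by
      by_contra! h
      exact absurd hs₀1 (not_lt.mpr (hβs ▸ one_le_pow₀ h))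
    have h1 := pow_le_pow_left₀ zero_le (hs₀max c hc1) 3
    rw [hβs] at h1
    have h2 : P₀.ring.valuation (s₀ : K') ^ 3 < P₀.ring.valuation (s₀ : K') := by
      conv_rhs => rw [← pow_one (P₀.ring.valuation (s₀ : K'))]
      exact pow_lt_pow_right_of_lt_one₀ hs₀pos hs₀1 (by norm_num)
    exact absurd h1 (not_le.mpr h2)
  have hdeg' : (minpoly K' (u + v)).natDegree = 3 :=
    natDegree_minpoly_add_eq_three (F := K') (a := algebraMap K K' a) hmul hu.symm hcube
  have hint : IsIntegral K (u + v) := Algebra.IsIntegral.isIntegral _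
  have hroot : (u + v) ^ 3 = 3 * algebraMap K Ω a * (u + v) + algebraMap K Ω b := by
    rw [← hmul, ← hbΩ]
    ring
  have hdeg : (minpoly K (u + v)).natDegree = 3 := by
    refine le_antisymm ?_ ?_
    · have h1 : aeval (u + v) (X ^ 3 - (C (3 * a) * X + C b) : K[X]) = 0 := by
        simp only [map_sub, map_add, map_mul, map_pow, aeval_X, aeval_C, hroot, map_ofNat]
        ring
      have h2 : (C (3 * a) * X + C b : K[X]).degree < 3 :=
        degree_linear_le.trans_lt (by norm_num)
      have h3 : (X ^ 3 - (C (3 * a) * X + C b) : K[X]).Monic := monic_X_pow_sub h2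
      refine (natDegree_le_of_dvd (minpoly.dvd K _ h1) h3.ne_zero).trans ?_
      refine natDegree_le_of_degree_le (degree_sub_le_of_le ?_ ?_ |>.trans (max_self _).le)
      · exact (degree_X_pow 3).le
      · exact h2.le
    · have h1 := minpoly.dvd_map_of_isScalarTower K K' (u + v)
      have h2 := natDegree_le_of_dvd h1 ((minpoly.monic hint).map _).ne_zero
      rwa [hdeg', natDegree_map] at h2
  have hfin : Module.finrank K K⟮u + v⟯ = 3 := by rw [adjoin.finrank hint, hdeg]
  have : FiniteDimensional K K⟮u + v⟯ := adjoin.finiteDimensional hint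
  let θ : K⟮u + v⟯ := ⟨u + v, mem_adjoin_simple_self K _⟩
  have hrootL : θ ^ 3 = 3 * algebraMap K K⟮u + v⟯ a * θ + algebraMap K K⟮u + v⟯ b :=
    Subtype.ext hroot
  have hram : ∀ p ∈ T, ∀ 𝔓 : Place k K⟮u + v⟯, 𝔓.LiesOver p → 𝔓.ramificationIdx K = 3 := by
    intro p hp 𝔓 h𝔓
    obtain ⟨P, s, hP, hs, hs0, h1, h2⟩ := hγT p hp
    obtain ⟨h4, h5⟩ := hvalβ hs0 h1 h2
    obtain ⟨hs1, hsmax⟩ := (P.ring.maximalIdeal_eq_span_iff s).mp hs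
    have hspos : 0 < P.ring.valuation (s : K') :=
      zero_lt_iff.mpr ((Valuation.ne_zero_iff _).mpr hs0)
    -- The trace `b` of `β` has the simple pole of `σ β`.
    have hbval : P.ring.valuation (algebraMap K K' b) = (P.ring.valuation (s : K'))⁻¹ := by
      rw [hb, Valuation.map_add_eq_of_lt_right, h5]
      rw [h4, h5]
      exact hs1.trans ((one_lt_inv₀ hspos).mpr hs1)
    have hb0 : b ≠ 0 := by
      rintro rfl
      rw [map_zero, map_zero, eq_comm, inv_eq_zero] at hbval
      exact hspos.ne' hbval
    have hbinv : P.ring.valuation (algebraMap K K' b⁻¹) = P.ring.valuation (s : K') := by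
      rw [map_inv₀, map_inv₀, hbval, inv_inv]
    have hlt : ∀ c : K, p.ring.valuation c < 1 ↔ P.ring.valuation (algebraMap K K' c) < 1 := by
      intro c
      have := valuation_lt_iff_of_comap_eq hP c 1
      rw [map_one, map_one, map_one] at this
      exact this.symm
    have hb1 : p.ring.valuation b⁻¹ < 1 := by
      rw [hlt, hbinv]
      exact hs1
    refine Place.ramificationIdx_eq_three_of_root hK hfin h𝔓 hrootL ?_
      (t := ⟨b⁻¹, (ValuationSubring.valuation_le_one_iff _ _).mp hb1.le⟩) ?_ (inv_ne_zero hb0) ?_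
    · have h6 := (valuation_le_iff_of_comap_eq hP a 1).mp (by
        rw [ha, map_mul, h1, h2, mul_inv_cancel₀ hspos.ne', map_one, map_one])
      rwa [map_one] at h6
    · rw [ValuationSubring.maximalIdeal_eq_span_iff]
      refine ⟨hb1, fun c hc => ?_⟩
      rw [← valuation_le_iff_of_comap_eq hP, hbinv]
      exact hsmax _ ((hlt c).mp hc)
    · rw [map_inv₀, inv_inv]
  refine ⟨K⟮u + v⟯, ⟨hfin, isSeparable_adjoin_of_natDegree_eq_three h3K hdeg, ?_⟩,
    isPurelyCubicClosure_adjoin h3K hmul hu.symm hv3 hb.symm hu0 htop hdeg', fun p => ⟨?_, ?_⟩⟩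
  · obtain ⟨𝔓, h𝔓⟩ := p₀.exists_liesOver K⟮u + v⟯
    exact Place.not_constant_extension_of_ramificationIdx hK h𝔓 (hram p₀ hp₀ 𝔓 h𝔓)
  · rintro ⟨𝔓, h𝔓, he⟩
    by_contra hp
    obtain ⟨W, hW⟩ := exists_valuationSubring_comap_eq Ω 𝔓.ring
    have hWp : W.comap (algebraMap K Ω) = p.ring := by rw [← h𝔓, ← hW]; rfl
    let Q : Place k K' := p.ofComapEq (W.comap (algebraMap K' Ω)) hWp
    obtain ⟨h1, h2⟩ := hγ1 Q p hWp hp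
    have hβ1 : Q.ring.valuation β = 1 := by
      rw [hβ, map_mul, map_pow, h1, h2, one_pow, one_mul]
    have hu1 : W.valuation u = 1 := by
      have h4 : W.valuation u ^ 3 = 1 := by
        rw [← map_pow, hu]
        have h5 := (valuation_eq_iff_of_comap_eq (A := Q.ring) (B := W) rfl β 1).mpr
          (by rw [hβ1, map_one])
        rw [map_one, map_one] at h5
        exact h5
      exact (pow_eq_one_iff_of_nonneg zero_le three_ne_zero).mp h4
    refine 𝔓.ramificationIdx_ne_three hK h3 hquad h𝔓 hW hu hu1 (fun s => ?_) (he.trans hfin)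
    have hmem : u + v ∈ K'⟮u⟯.restrictScalars K :=
      add_mem (mem_adjoin_simple_self K' u) (div_mem
        (IntermediateField.algebraMap_mem K'⟮u⟯ (algebraMap K K' a)) (mem_adjoin_simple_self K' u))
    exact (adjoin_simple_le_iff.mpr hmem) s.2
  · intro hp
    obtain ⟨𝔓, h𝔓⟩ := p.exists_liesOver K⟮u + v⟯
    exact ⟨𝔓, h𝔓, (hram p hp 𝔓 h𝔓).trans hfin.symm⟩

end Construction

end FunctionFieldPlaces

open FunctionFieldPlaces in
theorem mainTheorem1 {k K Ω : Type*} [Field k] [PerfectField k] (hk : ringChar k ≠ 3)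
    [Field K] [Algebra k K] (hK : IsFunctionField k K)
    [Field Ω] [Algebra K Ω] [IsAlgClosure K Ω] [Algebra k Ω] [IsScalarTower k K Ω]
    (K' : IntermediateField K Ω) (hquad : Module.finrank K K' = 2)
    (hgenus : HasGenus (algebraicClosure k K') K' 0)
    (T : Set (Place k K)) (hTfin : T.Finite) (hTne : T.Nonempty) :
    (∃ L : IntermediateField K Ω, IsCubicExtension k K L ∧ IsPurelyCubicClosure L K' ∧
      ∀ p : Place k K, p.IsTotallyRamifiedIn L ↔ p ∈ T) ↔
    ∀ p ∈ T, p.SplitsIn K' := by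
  have : IsAlgClosed Ω := IsAlgClosure.isAlgClosed K
  have : Algebra.IsAlgebraic K Ω := IsAlgClosure.isAlgebraic
  have h3 : (3 : k) ≠ 0 := by
    intro h
    have h1 : ringChar k ∣ 3 := ringChar.dvd (by exact_mod_cast h)
    rcases (Nat.dvd_prime Nat.prime_three).mp h1 with h2 | h2
    · exact CharP.ringChar_ne_one h2
    · exact hk h2
  refine ⟨?_, exists_isCubicExtension_of_splitsIn hK h3 hquad hgenus hTfin hTne⟩
  rintro ⟨L, hL, hcl, hram⟩ p hp
  exact Place.splitsIn_of_isTotallyRamifiedIn hK h3 hL.finrank_eq hquad hcl ((hram p).mpr hp)
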